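/- Let $\mathbb T^3=(-\pi,\pi)^3$ with periodic boundary conditions, $H=L^2(\mathbb T^3;\mathbb C)$, and let $\omega\in\mathbb R$, $\omega\neq0$, be fixed. For $N\in\mathbb N$ let $P_N$ be the orthogonal projector of $H$ onto the (finite-dimensional) span of all eigenfunctions of $-\Delta$ on $\mathbb T^3$ with eigenvalue at most $N$. Then for every $K\ge0$ there are an infinite set $S\subset\mathbb N$ and, for each $N\in S$, real constants $C_N$ and $\theta_N$, with $S$ depending only on $K$, and $C_N,\theta_N$ depending only on $N$ and $K$ (besides the fixed $\omega$), such that the following holds for every $N\in S$. Let $a,b\in C^1(\mathbb R\times\mathbb T^3;\mathbb C)$ satisfy $$\|a\|_{C^1_b(\mathbb R\times\mathbb T^3)}+\|b\|_{C^1_b(\mathbb R\times\mathbb T^3)}\le K,$$ where $\|a\|_{C^1_b}=\sup|a|+\sup|D_{t,x}a|$ (the spatial means of $a$ and $b$ need not vanish). Then every bounded backward weak solution $v\in C_b((-\infty,0];H)$ of $$\partial_t v-(1+i\omega)\Delta v+a(t,x)v+b(t,x)\bar v=0,\qquad t\le0,$$ satisfies $$\|v(t)\|_H\le C_N e^{-\theta_N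 t}\|P_Nv(0)\|_H,\qquad t\le0.$$ -/

import Mathlib

open MeasureTheory Set
open scoped ENNReal NNReal Real

noncomputable section

namespace GinzburgLandau

instance factTwoPiPos : Fact (0 < 2 * π) := ⟨Real.two_pi_pos⟩

/-- Euclidean space `ℝ³`. -/
abbrev Space : Type := EuclideanSpace ℝ (Fin 3)

/-- The torus `𝕋³ = (ℝ / 2πℤ)³`, that is, the cube `(-π, π)³` with opposite faces identified.
Its `volume` is Lebesgue measure, of total mass `(2π)³`. -/
abbrev Torus : Type := Fin 3 → AddCircle (2 * π)

/-- The covering map `ℝ³ → 𝕋³`. -/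
def proj (x : Space) : Torus := fun i => (x i : AddCircle (2 * π))

/-- The Hilbert space `H = L²(𝕋³; ℂ)`. -/
abbrev H : Type := Lp ℂ 2 (volume : Measure Torus)

/-- Smooth functions on the torus (equivalently, smooth functions on `ℝ³` that are `2π`-periodic
in each variable). -/
def IsSmooth (φ : Torus → ℂ) : Prop := ContDiff ℝ ((⊤ : ℕ∞) : WithTop ℕ∞) fun x : Space => φ (proj x)

/-- The Laplacian of a function on the torus at the point `y`: the Euclidean Laplacian, at the
origin, of the function read in the flat local coordinates `x ↦ y + proj x` centred at `y`. -/
def torusLaplacian (φ : Torus → ℂ) (y : Torus) : ℂ :=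
  Laplacian.laplacian (fun x : Space => φ (y + proj x)) 0

/-- A function on `ℝ × 𝕋³` read as a function on `ℝ × ℝ³`, periodic in the space variable. -/
def lift (a : ℝ → Torus → ℂ) (p : ℝ × Space) : ℂ := a p.1 (proj p.2)

/-- The `C¹_b(ℝ × 𝕋³)` norm `sup |a| + sup |D_{t,x} a|` (possibly infinite) of a `C¹` function. -/
def c1Norm (a : ℝ → Torus → ℂ) : ℝ≥0∞ :=
  (⨆ p : ℝ × Space, ‖lift a p‖ₑ) + ⨆ p : ℝ × Space, ‖fderiv ℝ (lift a) p‖ₑ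

/-- The coefficients `a` and `b` are `C¹` on `ℝ × 𝕋³`, and
`‖a‖_{C¹_b(ℝ × 𝕋³)} + ‖b‖_{C¹_b(ℝ × 𝕋³)} ≤ K`. -/
structure CoeffBound (K : ℝ≥0) (a b : ℝ → Torus → ℂ) : Prop where
  contDiff_left : ContDiff ℝ 1 (lift a)
  contDiff_right : ContDiff ℝ 1 (lift b)
  bound : c1Norm a + c1Norm b ≤ K

/-- The (closed) linear span `H_N` in `H` of all eigenvectors of `-Δ` on the torus whose
eigenvalue is at most `N`.  The span is finite dimensional, so that taking its closure changes
nothing; it only spares a proof of completeness. -/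
def lowModes (N : ℕ) : Submodule ℂ H :=
  (Submodule.span ℂ {u : H | ∃ (φ : Torus → ℂ) (l : ℝ), IsSmooth φ ∧ l ≤ N ∧
    (∀ y, -torusLaplacian φ y = l * φ y) ∧ u =ᵐ[volume] φ}).topologicalClosure

instance completeSpaceLowModes (N : ℕ) : CompleteSpace (lowModes N) := by
  unfold lowModes; infer_instance

/-- The orthogonal projector `P_N` of `H` onto `H_N`. -/
def P (N : ℕ) : H →L[ℂ] H := (lowModes N).starProjection

/-- `v ∈ C_b(ℝ₋, H)` is a bounded backward solution of
`∂ₜ v - (1 + iω) Δ v + a v + b v̄ = 0`, `t ≤ 0`, in the usual weak sense: the equation holds, for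
all times `t ≤ 0`, when it is tested with an arbitrary smooth function of the space variable.
Only the values `v t` with `t ≤ 0` matter, and the time derivative at `t = 0` is one-sided. -/
structure IsBoundedBackwardSolution (ω : ℝ) (a b : ℝ → Torus → ℂ) (v : ℝ → H) : Prop where
  continuousOn : ContinuousOn v (Iic 0)
  bounded : ∃ M : ℝ, ∀ t ≤ 0, ‖v t‖ ≤ M
  equation : ∀ φ : Torus → ℂ, IsSmooth φ → ∀ t ≤ 0,
    HasDerivWithinAt (fun s : ℝ => ∫ x, v s x * φ x)
      ((1 + Complex.I * ω) * (∫ x, v t x * torusLaplacian φ x)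
        - ∫ x, (a t x * v t x + b t x * (starRingEnd ℂ) (v t x)) * φ x)
      (Iic 0) t

end GinzburgLandau

end

/-!
The equation is studied on the side of the Fourier coefficients `v_k`, `k ∈ ℤ³`, with respect to the
eigenfunctions of `-Δ`, whose eigenvalues are the integers `|k|²` (`freqSq`). The point is to show
that a bounded backward solution lives in the cone `‖v‖² ≤ 4 ‖P_N v‖²`
(`norm_sq_le_four_mul_energy`); in this cone the low modes satisfy a differential inequality that
allows at most exponential growth backward in time (`energy_le_exp_mul`).

Invariance of the cone would be immediate if the spectral gap at `N` were large compared to `K`, but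
in dimension three the gaps stay bounded. Two averaging effects replace it.

* Spatial averaging. There are arbitrarily large `N` such that distinct lattice points of the window
  `| |k|² - N | ≤ κ` are far apart (`exists_sparse_window`). Restricted to such a band of
  modes, multiplication by a `C¹` function nearly reduces to multiplication by its mean
  (`exists_coef_reaction_band`): functions with a given `C¹` bound are uniformly approximated by
  trigonometric polynomials of bounded degree, by the theorems of Arzelà-Ascoli and
  Stone-Weierstrass. Outside the band, the distance `κ` to `N` beats the lower order terms.
* Temporal averaging. The mean of `a` acts as a scalar and only changes the rate at which the
  indefinite form `‖(1 - P_N) v‖² - ‖P_N v‖²` decays. The mean of `b` acts through the resonant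
  sum `∑ ± v_k v_{-k}` over the band, which rotates with frequency `2 ω N` since `ω ≠ 0`; its effect
  is removed by adding to the form a corrector of size `O(K / (|ω| N))`. The `C¹` bound in time keeps
  the derivative of the corrector small.

The corrected form is a strict Lyapunov functional (`lyapunov_deriv_le`). If it were positive
at some time it would grow exponentially backward, contradicting boundedness; hence it is
nonpositive, which is the cone condition. As solutions are merely continuous in `L²`, the functional
is differentiated after truncation to finitely many modes, and the truncation is removed with the
help of Dini's theorem.
-/

noncomputable section

namespace GinzburgLandau

open scoped ComplexConjugate InnerProductSpace

/-! ### Sparse spectral windows: arithmetic of `|k|²` on `ℤ³` -/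

/-- The eigenvalue `|k|² = k₀² + k₁² + k₂²` of `-Δ` on the torus at the frequency `k ∈ ℤ³`. -/
def freqSq (k : Fin 3 → ℤ) : ℤ := ∑ i, k i ^ 2

lemma freqSq_eq (k : Fin 3 → ℤ) : freqSq k = k 0 ^ 2 + k 1 ^ 2 + k 2 ^ 2 := by
  simp [freqSq, Fin.sum_univ_three]

lemma freqSq_nonneg (k : Fin 3 → ℤ) : 0 ≤ freqSq k :=
  Finset.sum_nonneg fun i _ => sq_nonneg (k i)

lemma freqSq_neg (k : Fin 3 → ℤ) : freqSq (-k) = freqSq k := by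
  simp [freqSq]

lemma freqSq_pos {k : Fin 3 → ℤ} (hk : k ≠ 0) : 0 < freqSq k := by
  obtain ⟨i, hi⟩ := Function.ne_iff.1 hk
  exact Finset.sum_pos' (fun i _ => sq_nonneg (k i))
    ⟨i, Finset.mem_univ i, sq_pos_of_ne_zero hi⟩

/-- Arbitrarily large primes modulo which `-D` is a quadratic non-residue: those congruent to
`-1` modulo `4 D`, by quadratic reciprocity. -/
lemma exists_prime_not_isSquare_neg {D : ℕ} (hD : 0 < D) (n : ℕ) :
    ∃ p : ℕ, n < p ∧ ∃ _ : Fact p.Prime, ¬ IsSquare (-(D : ZMod p)) := by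
  have h4 : NeZero (4 * D) := ⟨by positivity⟩
  have hunit : IsUnit (-1 : ZMod (4 * D)) := isUnit_one.neg
  obtain ⟨p, hpn, hp, hpmod⟩ := Nat.forall_exists_prime_gt_and_eq_mod hunit (max n 2)
  have hpf : Fact p.Prime := ⟨hp⟩
  refine ⟨p, (le_max_left _ _).trans_lt hpn, hpf, ?_⟩
  have hp2 : 2 < p := (le_max_right _ _).trans_lt hpn
  have hodd : Odd p := hp.odd_of_ne_two hp2.ne'
  have hmod : p % (4 * D) = 4 * D - 1 := by
    have h1 : ((p : ℕ) : ZMod (4 * D)) = ((4 * D - 1 : ℕ) : ZMod (4 * D)) := by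
      rw [hpmod, Nat.cast_sub (by omega), ZMod.natCast_self]; simp
    have := (ZMod.natCast_eq_natCast_iff' _ _ _).1 h1
    rwa [Nat.mod_eq_of_lt (a := 4 * D - 1) (by omega)] at this
  have hq4 : (4 * D - 1) % 4 = 3 := by omega
  -- modulo `4 D - 1` the number `4` is a square and inverse to `D`
  have hJ : jacobiSym (-(D : ℤ)) (4 * D - 1) = -1 := by
    have hqodd : Odd (4 * D - 1) := Nat.odd_iff.2 (by omega)
    have h1 : jacobiSym ((-(D : ℤ)) * 2 ^ 2) (4 * D - 1) = jacobiSym (-1) (4 * D - 1) := by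
      rw [jacobiSym.mod_left, jacobiSym.mod_left (-1)]
      congr 1
      refine Int.ModEq.symm ((Int.modEq_iff_dvd).2 ⟨-1, ?_⟩)
      push_cast [Nat.cast_sub (show 1 ≤ 4 * D by omega)]
      ring
    have h2 : jacobiSym ((2 : ℤ) ^ 2) (4 * D - 1) = 1 := by
      refine jacobiSym.sq_one' ?_
      have : Nat.Coprime 2 (4 * D - 1) := (Nat.coprime_two_left).2 hqodd
      exact_mod_cast this
    rw [jacobiSym.mul_left, h2, mul_one] at h1
    rw [h1, jacobiSym.at_neg_one hqodd, ZMod.χ₄_nat_three_mod_four hq4]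
  have hL : jacobiSym (-(D : ℤ)) p = -1 := by
    rw [jacobiSym.mod_right _ hodd, Int.natAbs_neg, Int.natAbs_natCast, hmod, hJ]
  rw [← jacobiSym.legendreSym.to_jacobiSym, legendreSym.eq_neg_one_iff] at hL
  simpa using hL

/-- If `-D` is not a square modulo `p`, the binary quadratic form `|k|² D - (k ⬝ j)² = |k × j|²`
on the plane orthogonal to `j`, `|j|² = D`, is anisotropic modulo `p`; so it never takes a
value divisible by `p` exactly once. -/
lemma sq_dvd_of_dvd_cross {p : ℕ} [Fact p.Prime] {k j : Fin 3 → ℤ}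
    (hns : ¬ IsSquare (-((freqSq j : ℤ) : ZMod p)))
    (hdvd : (p : ℤ) ∣ freqSq k * freqSq j - (∑ i, k i * j i) ^ 2) :
    (p : ℤ) ^ 2 ∣ freqSq k * freqSq j - (∑ i, k i * j i) ^ 2 := by
  have key : ∀ x y c : ℤ, x ^ 2 + freqSq j * y ^ 2 =
      c * (freqSq k * freqSq j - (∑ i, k i * j i) ^ 2) → (p : ℤ) ∣ y := by
    intro x y c h
    have h0 : ((x ^ 2 + freqSq j * y ^ 2 : ℤ) : ZMod p) = 0 := by
      rw [h]; exact (ZMod.intCast_zmod_eq_zero_iff_dvd _ _).2 (hdvd.mul_left c)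
    rw [← ZMod.intCast_zmod_eq_zero_iff_dvd]
    by_contra hy
    refine hns ⟨(x : ZMod p) / y, ?_⟩
    push_cast at h0
    field_simp
    linear_combination -h0
  simp only [freqSq_eq, Fin.sum_univ_three] at key ⊢
  have h0 := key ((k 0 * j 1 - k 1 * j 0) * j 1 - (k 2 * j 0 - k 0 * j 2) * j 2)
    (k 1 * j 2 - k 2 * j 1) (j 1 ^ 2 + j 2 ^ 2) (by ring)
  have h1 := key ((k 1 * j 2 - k 2 * j 1) * j 2 - (k 0 * j 1 - k 1 * j 0) * j 0)
    (k 2 * j 0 - k 0 * j 2) (j 2 ^ 2 + j 0 ^ 2) (by ring)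
  have h2 := key ((k 2 * j 0 - k 0 * j 2) * j 0 - (k 1 * j 2 - k 2 * j 1) * j 1)
    (k 0 * j 1 - k 1 * j 0) (j 0 ^ 2 + j 1 ^ 2) (by ring)
  have := dvd_add (dvd_add (pow_dvd_pow_of_dvd h0 2) (pow_dvd_pow_of_dvd h1 2))
    (pow_dvd_pow_of_dvd h2 2)
  refine (this.trans (dvd_of_eq ?_))
  ring

/-- A congruence condition on `n`, with modulus prime to any given `q`, under which no lattice
point `k` on a plane `k ⬝ j = m`, `|j|² = D`, has `|k|² = n + s`. -/
lemma exists_avoiding_residue {D : ℕ} (hD : 0 < D) (s m : ℤ) {q : ℤ} (hq : 0 < q) :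
    ∃ p r : ℤ, 0 < p ∧ IsCoprime q p ∧ ∀ n : ℤ, p ∣ n - r → ∀ k j : Fin 3 → ℤ,
      freqSq j = D → ∑ i, k i * j i = m → freqSq k ≠ n + s := by
  obtain ⟨p, hp, hpf, hns⟩ := exists_prime_not_isSquare_neg hD (max q.natAbs D)
  have hpp : p.Prime := hpf.out
  have hcop : ∀ x : ℕ, 0 < x → x < p → IsCoprime (x : ℤ) ((p : ℤ) ^ 2) := fun x hx hxp => by
    refine IsCoprime.pow_right (Int.isCoprime_iff_gcd_eq_one.2 ?_)
    simpa using (Nat.coprime_of_lt_prime hx.ne' hxp hpp).symm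
  have hqp : IsCoprime q ((p : ℤ) ^ 2) := by
    have := hcop q.natAbs (by omega) (by omega)
    rwa [Int.natCast_natAbs, abs_of_pos hq] at this
  obtain ⟨x, y, hxy⟩ := hcop D hD (by omega)
  -- `r` solves `D (r + s) - m² = p` modulo `p²`
  refine ⟨(p : ℤ) ^ 2, x * (m ^ 2 + p) - s, by have := hpp.pos; positivity, hqp, ?_⟩
  rintro n ⟨c, hc⟩ k j hj hm hk
  have hns' : ¬ IsSquare (-((freqSq j : ℤ) : ZMod p)) := by rw [hj]; simpa using hns
  have hval : freqSq k * freqSq j - (∑ i, k i * j i) ^ 2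
      = p + (p : ℤ) ^ 2 * (c * D - y * (m ^ 2 + p)) := by
    rw [hk, hj, hm]
    linear_combination (D : ℤ) * hc + (m ^ 2 + (p : ℤ)) * hxy
  have hsq := sq_dvd_of_dvd_cross hns' (k := k)
    (by rw [hval]; exact ⟨1 + p * (c * D - y * (m ^ 2 + p)), by ring⟩)
  rw [hval] at hsq
  have h1 : (p : ℤ) ^ 2 ∣ p := (Int.dvd_add_left (Dvd.intro _ rfl)).1 hsq
  have h2 := Int.le_of_dvd (by exact_mod_cast hpp.pos) h1
  have h3 : (2 : ℤ) ≤ p := by exact_mod_cast hpp.two_le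
  nlinarith

/-- Chinese remaindering: finitely many congruence conditions, each available with modulus prime
to any given number, hold simultaneously along an arithmetic progression. -/
lemma exists_progression_of_finset {τ : Type*} (A : τ → ℤ → Prop) (T : Finset τ)
    (h : ∀ x ∈ T, ∀ q : ℤ, 0 < q → ∃ p r : ℤ, 0 < p ∧ IsCoprime q p ∧ ∀ n, p ∣ n - r → A x n) :
    ∃ q r : ℤ, 0 < q ∧ ∀ n, q ∣ n - r → ∀ x ∈ T, A x n := by
  classical
  induction T using Finset.induction_on with
  | empty => exact ⟨1, 0, one_pos, by simp⟩
  | insert x T _ ih =>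
    obtain ⟨q, r, hq, hr⟩ := ih fun y hy => h y (Finset.mem_insert_of_mem hy)
    obtain ⟨p, r', hp, ⟨c, d, hcd⟩, hA⟩ := h x (Finset.mem_insert_self x T) q hq
    refine ⟨q * p, r * (d * p) + r' * (c * q), mul_pos hq hp, fun n hn y hy => ?_⟩
    obtain ⟨e, he⟩ := hn
    rcases Finset.mem_insert.1 hy with rfl | hy
    · exact hA n ⟨q * e + d * (r - r'), by linear_combination he + r' * hcd⟩
    · exact hr n ⟨p * e + c * (r' - r), by linear_combination he + r * hcd⟩ y hy

/-- Spectral windows `[N - κ, N + κ]`, with `N` arbitrarily large, in which any two distinct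
lattice points are further than `√R` apart. Two close points `k` and `k - j` of the window put
`k` on one of finitely many planes `k ⬝ j = m`, which congruences on `N` exclude. -/
theorem exists_sparse_window (κ R M : ℕ) : ∃ N : ℕ, M ≤ N ∧ ∀ k l : Fin 3 → ℤ, k ≠ l →
    |freqSq k - N| ≤ κ → |freqSq l - N| ≤ κ → (R : ℤ) < freqSq (k - l) := by
  let T : Finset (ℕ × ℤ × ℤ) := Finset.Icc 1 R ×ˢ Finset.Icc (-(κ : ℤ)) κ ×ˢ
    Finset.Icc (-(2 * κ + R : ℤ)) (2 * κ + R)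
  obtain ⟨q, r, hq, hr⟩ := exists_progression_of_finset
    (fun (x : ℕ × ℤ × ℤ) (n : ℤ) => ∀ k j : Fin 3 → ℤ,
      freqSq j = x.1 → ∑ i, k i * j i = x.2.2 → freqSq k ≠ n + x.2.1) T
    (fun x hx q hq => exists_avoiding_residue (by simp [T] at hx; omega) x.2.1 x.2.2 hq)
  refine ⟨(r + q * (|r| + M)).toNat, ?_, ?_⟩
  · have := neg_abs_le r
    have : |r| + M ≤ q * (|r| + M) := le_mul_of_one_le_left (by positivity) hq
    omega
  · have hN : ((r + q * (|r| + M)).toNat : ℤ) = r + q * (|r| + M) := by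
      have := neg_abs_le r
      have : |r| + M ≤ q * (|r| + M) := le_mul_of_one_le_left (by positivity) hq
      omega
    intro k l hkl hk hl
    rw [hN] at hk hl
    set N := r + q * (|r| + M)
    by_contra! hR
    have hpos := freqSq_pos (sub_ne_zero.2 hkl)
    have hexp : 2 * ∑ i, k i * (k - l) i = freqSq k - freqSq l + freqSq (k - l) := by
      simp only [freqSq_eq, Fin.sum_univ_three, Pi.sub_apply]; ring
    rw [abs_le] at hk hl
    refine hr N ⟨|r| + M, by simp [N]⟩ ((freqSq (k - l)).toNat, freqSq k - N,
      ∑ i, k i * (k - l) i) ?_ k (k - l) (by simp; omega) rfl (by simp)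
    simp only [T, Finset.mem_product, Finset.mem_Icc]
    omega

/-! ### Fourier series on the torus -/


/-- The character `x ↦ e^{i k · x}` of the torus. -/
def chi (k : Fin 3 → ℤ) : C(Torus, ℂ) where
  toFun x := ∏ i, fourier (k i) (x i)
  continuous_toFun := by fun_prop

lemma chi_apply (k : Fin 3 → ℤ) (x : Torus) : chi k x = ∏ i, fourier (k i) (x i) := rfl

lemma chi_neg (k : Fin 3 → ℤ) (x : Torus) : chi (-k) x = conj (chi k x) := by
  simp only [chi_apply, Pi.neg_apply, fourier_neg, map_prod]

lemma chi_add (k l : Fin 3 → ℤ) (x : Torus) : chi (k + l) x = chi k x * chi l x := by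
  simp only [chi_apply, Pi.add_apply, fourier_add, ← Finset.prod_mul_distrib]

lemma chi_zero : chi 0 = 1 := by
  ext x; simp [chi_apply]

lemma chi_apply_add (k : Fin 3 → ℤ) (x y : Torus) : chi k (x + y) = chi k x * chi k y := by
  simp only [chi_apply, Pi.add_apply, fourier_apply, zsmul_add, AddCircle.toCircle_add,
    Circle.coe_mul, Finset.prod_mul_distrib]

/-- The real-linear phase `x ↦ i k · x` of the character of frequency `k`. -/
def phase (k : Fin 3 → ℤ) : Space →L[ℝ] ℂ :=
  ∑ i, (Complex.I * k i) • Complex.ofRealCLM.comp (EuclideanSpace.proj i)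

lemma phase_apply (k : Fin 3 → ℤ) (x : Space) : phase k x = ∑ i, Complex.I * k i * x i := by
  simp [phase]

lemma chi_proj (k : Fin 3 → ℤ) (x : Space) : chi k (proj x) = Complex.exp (phase k x) := by
  rw [chi_apply, phase_apply, Complex.exp_sum]
  refine Finset.prod_congr rfl fun i _ => ?_
  rw [proj, fourier_coe_apply]
  congr 1
  have : (π : ℂ) ≠ 0 := by exact_mod_cast Real.pi_ne_zero
  push_cast
  field_simp

lemma isSmooth_chi (k : Fin 3 → ℤ) : IsSmooth (chi k) := by
  simp only [IsSmooth, chi_proj]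
  exact (phase k).contDiff.cexp

lemma torusLaplacian_chi (k : Fin 3 → ℤ) (y : Torus) :
    torusLaplacian (chi k) y = -(freqSq k : ℂ) * chi k y := by
  set f : Space → ℂ := fun x => chi k y * Complex.exp (phase k x) with hf
  have hfe : (fun x : Space => chi k (y + proj x)) = f := by
    ext x; rw [chi_apply_add, chi_proj]
  have hd : ∀ x, HasFDerivAt f (f x • phase k) x := fun x => by
    have := ((phase k).hasFDerivAt (x := x)).cexp.const_mul (chi k y)
    rwa [smul_smul] at this
  have hdf : fderiv ℝ f = fun x => f x • phase k := funext fun x => (hd x).fderiv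
  have hd2 : fderiv ℝ (fderiv ℝ f) 0 = (f 0 • phase k).smulRight (phase k) := by
    rw [hdf]; exact ((hd 0).smul_const (phase k)).fderiv
  rw [torusLaplacian, hfe, InnerProductSpace.laplacian_eq_iteratedFDeriv_orthonormalBasis f
    (EuclideanSpace.basisFun (Fin 3) ℝ)]
  have h0 : f 0 = chi k y := by simp [hf]
  have hp : ∀ i, phase k (EuclideanSpace.single i 1) = Complex.I * k i := fun i => by
    rw [phase_apply, Finset.sum_eq_single i] <;> simp +contextual
  simp only [iteratedFDeriv_two_apply, hd2, EuclideanSpace.basisFun_apply, Matrix.cons_val_zero,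
    Matrix.cons_val_one, ContinuousLinearMap.smulRight_apply, _root_.smul_apply,
    hp, h0, smul_eq_mul, freqSq, Fin.sum_univ_three]
  push_cast
  linear_combination (chi k y * ((k 0 : ℂ) ^ 2 + (k 1 : ℂ) ^ 2 + (k 2 : ℂ) ^ 2)) * Complex.I_sq

/-- The characters separate the points of the torus, so trigonometric polynomials are dense in
the continuous functions. -/
lemma span_chi_closure_eq_top : (Submodule.span ℂ (range chi)).topologicalClosure = ⊤ := by
  let A : StarSubalgebra ℂ C(Torus, ℂ) :=
    { toSubalgebra := Algebra.adjoin ℂ (range chi)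
      star_mem' := by
        change Algebra.adjoin ℂ (range chi) ≤ star (Algebra.adjoin ℂ (range chi))
        refine Algebra.adjoin_le ?_
        rintro _ ⟨k, rfl⟩
        refine Algebra.subset_adjoin ⟨-k, ?_⟩
        ext x
        simp only [chi_neg, starRingEnd_apply, ContinuousMap.star_apply] }
  have hA : A.toSubalgebra.toSubmodule = Submodule.span ℂ (range chi) := by
    apply Algebra.adjoin_eq_span_of_subset
    refine .trans (fun x ↦ Submonoid.closure_induction (fun _ ↦ id) ⟨0, chi_zero⟩ ?_)
      Submodule.subset_span
    rintro _ _ _ _ ⟨k, rfl⟩ ⟨l, rfl⟩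
    exact ⟨k + l, ContinuousMap.ext fun x => chi_add k l x⟩
  have hsep : A.SeparatesPoints := by
    intro x y hxy
    obtain ⟨i, hi⟩ := Function.ne_iff.1 hxy
    have hsingle : ∀ z : Torus, chi (Pi.single i 1) z = fourier 1 (z i) := fun z => by
      rw [chi_apply, Finset.prod_eq_single i] <;> simp +contextual
    refine ⟨_, ⟨chi (Pi.single i 1), Algebra.subset_adjoin ⟨_, rfl⟩, rfl⟩, ?_⟩
    intro h
    have h' : fourier 1 (x i) = fourier 1 (y i) := by rw [← hsingle x, ← hsingle y]; exact h
    rw [fourier_one, fourier_one] at h'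
    exact hi (AddCircle.injective_toCircle Real.two_pi_pos.ne' (Circle.coe_injective h'))
  rw [← hA]
  exact congr_arg (Subalgebra.toSubmodule <| StarSubalgebra.toSubalgebra ·)
    (ContinuousMap.starSubalgebra_topologicalClosure_eq_top_of_separatesPoints A hsep)

lemma volume_real_torus : (volume : Measure Torus).real univ = (2 * π) ^ 3 := by
  rw [Measure.real, volume_pi, Measure.pi_univ]
  simp [AddCircle.measure_univ, Real.pi_pos.le]

lemma integral_chi (k : Fin 3 → ℤ) :
    ∫ x, chi k x = if k = 0 then ((2 * π) ^ 3 : ℂ) else 0 := by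
  split_ifs with h
  · have := volume_real_torus
    simp [h, chi_zero, this]
  · obtain ⟨i, hi⟩ := Function.ne_iff.1 h
    simp only [chi_apply]
    rw [integral_fintype_prod_volume_eq_prod]
    exact Finset.prod_eq_zero (Finset.mem_univ i)
      (integral_eq_zero_of_add_right_eq_neg (fourier_add_half_inv_index hi Real.two_pi_pos))

/-- The factor `(2π)^{-3/2}` normalizing the characters in `L²`. -/
def normConst : ℝ := (√((2 * π) ^ 3))⁻¹

lemma normConst_sq : normConst ^ 2 * (2 * π) ^ 3 = 1 := by
  have : 0 < (2 * π) ^ 3 := pow_pos Real.two_pi_pos 3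
  rw [normConst, inv_pow, Real.sq_sqrt this.le, inv_mul_cancel₀ this.ne']

lemma normConst_pos : 0 < normConst :=
  inv_pos.2 (Real.sqrt_pos.2 (pow_pos Real.two_pi_pos 3))

/-- The normalized character of frequency `k`, as an element of `L²`. -/
def chiLp (k : Fin 3 → ℤ) : H :=
  (normConst : ℂ) • ContinuousMap.toLp (E := ℂ) 2 volume ℂ (chi k)

lemma orthonormal_chiLp : Orthonormal ℂ chiLp := by
  rw [orthonormal_iff_ite]
  intro k l
  simp only [chiLp, inner_smul_left, inner_smul_right, ContinuousMap.inner_toLp, ← chi_neg,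
    ← chi_add, integral_chi, Complex.conj_ofReal]
  have h := normConst_sq
  have h' : (normConst : ℂ) ^ 2 * (2 * π) ^ 3 = 1 := by exact_mod_cast h
  by_cases hkl : k = l
  · simp [hkl]; linear_combination h'
  · have : ¬ (l + -k = 0) := fun h => hkl (by rw [← sub_eq_add_neg, sub_eq_zero] at h; exact h.symm)
    simp [hkl, this]

lemma span_chiLp_closure_eq_top : (Submodule.span ℂ (range chiLp)).topologicalClosure = ⊤ := by
  have h1 : (Submodule.span ℂ (range fun k => ContinuousMap.toLp (E := ℂ) 2
      (volume : Measure Torus) ℂ (chi k))).topologicalClosure = ⊤ := by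
    simpa only [Submodule.map_span, ContinuousLinearMap.coe_coe, ← range_comp,
      Function.comp_def] using
      (ContinuousMap.toLp_denseRange (p := 2) ℂ (volume : Measure Torus) ℂ
        (by simp)).topologicalClosure_map_submodule span_chi_closure_eq_top
  rw [eq_top_iff, ← h1]
  refine Submodule.topologicalClosure_mono (Submodule.span_le.2 ?_)
  rintro _ ⟨k, rfl⟩
  have hc : (normConst : ℂ) ≠ 0 := by exact_mod_cast normConst_pos.ne'
  have : ContinuousMap.toLp (E := ℂ) 2 (volume : Measure Torus) ℂ (chi k)
      = (normConst : ℂ)⁻¹ • chiLp k := by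
    rw [chiLp, smul_smul, inv_mul_cancel₀ hc, one_smul]
  simp only [SetLike.mem_coe]
  rw [this]
  exact Submodule.smul_mem _ _ (Submodule.subset_span ⟨k, rfl⟩)

/-- The Hilbert basis of `L²(𝕋³)` formed by the normalized characters. -/
def fourierHilbertBasis : HilbertBasis (Fin 3 → ℤ) ℂ H :=
  HilbertBasis.mk orthonormal_chiLp span_chiLp_closure_eq_top.ge

/-- The Fourier coefficient of `u` at the frequency `k`, normalized so that Parseval's identity
holds without constants. -/
def coef (u : H) (k : Fin 3 → ℤ) : ℂ := fourierHilbertBasis.repr u k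

lemma coef_eq_inner (u : H) (k : Fin 3 → ℤ) : coef u k = ⟪chiLp k, u⟫_ℂ := by
  rw [coef, HilbertBasis.repr_apply_apply, fourierHilbertBasis, HilbertBasis.coe_mk]

lemma coef_eq_integral (u : H) (k : Fin 3 → ℤ) :
    coef u k = normConst * ∫ x, u x * chi (-k) x := by
  rw [coef_eq_inner, chiLp, inner_smul_left, Complex.conj_ofReal, L2.inner_def]
  congr 1
  refine integral_congr_ae ?_
  filter_upwards [ContinuousMap.coeFn_toLp (E := ℂ) (p := 2) (𝕜 := ℂ) volume (chi k)] with x hx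
  rw [hx, RCLike.inner_apply, chi_neg]

lemma coef_add (u w : H) (k : Fin 3 → ℤ) : coef (u + w) k = coef u k + coef w k := by
  simp [coef_eq_inner, inner_add_right]

lemma hasSum_normSq_coef (u : H) : HasSum (fun k => ‖coef u k‖ ^ 2) (‖u‖ ^ 2) := by
  have := fourierHilbertBasis.hasSum_inner_mul_inner u u
  have h2 := this.mapL (Complex.reCLM)
  have h3 : Complex.reCLM ⟪u, u⟫_ℂ = ‖u‖ ^ 2 := by
    rw [inner_self_eq_norm_sq_to_K]; simp [← Complex.ofReal_pow]
  rw [h3] at h2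
  convert h2 using 2 with k
  rw [← HilbertBasis.repr_apply_apply, ← inner_conj_symm, ← HilbertBasis.repr_apply_apply, coef]
  simp [Complex.conj_mul', ← Complex.ofReal_pow]

/-- The part of `‖u‖²` carried by the frequencies in `T`. -/
def energy (T : Finset (Fin 3 → ℤ)) (u : H) : ℝ := ∑ k ∈ T, ‖coef u k‖ ^ 2

lemma energy_nonneg (T : Finset (Fin 3 → ℤ)) (u : H) : 0 ≤ energy T u :=
  Finset.sum_nonneg fun _ _ => by positivity

lemma energy_le (T : Finset (Fin 3 → ℤ)) (u : H) : energy T u ≤ ‖u‖ ^ 2 :=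
  sum_le_hasSum T (fun _ _ => by positivity) (hasSum_normSq_coef u)

/-- The orthogonal projection of `u` onto the frequencies in `T`. -/
def trunc (T : Finset (Fin 3 → ℤ)) (u : H) : H := ∑ k ∈ T, coef u k • chiLp k

open Classical in
lemma coef_trunc (T : Finset (Fin 3 → ℤ)) (u : H) (k : Fin 3 → ℤ) :
    coef (trunc T u) k = if k ∈ T then coef u k else 0 := by
  rw [coef_eq_inner, trunc, inner_sum]
  simp [inner_smul_right, orthonormal_iff_ite.1 orthonormal_chiLp]

lemma norm_trunc_sq (T : Finset (Fin 3 → ℤ)) (u : H) : ‖trunc T u‖ ^ 2 = energy T u := by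
  classical
  refine (hasSum_normSq_coef _).unique ?_
  simp only [coef_trunc]
  have h : energy T u = ∑ k ∈ T, ‖if k ∈ T then coef u k else 0‖ ^ 2 :=
    Finset.sum_congr rfl fun k hk => by simp [hk]
  rw [h]
  exact hasSum_sum_of_ne_finset_zero fun k hk => by simp [hk]

lemma norm_sub_trunc_sq (T : Finset (Fin 3 → ℤ)) (u : H) :
    ‖u - trunc T u‖ ^ 2 = ‖u‖ ^ 2 - energy T u := by
  classical
  have h1 := (hasSum_normSq_coef u).sub (hasSum_normSq_coef (trunc T u))
  rw [norm_trunc_sq] at h1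
  refine (hasSum_normSq_coef _).unique ?_
  refine (funext fun k => ?_ : (fun k => ‖coef (u - trunc T u) k‖ ^ 2) = _) ▸ h1
  have : coef (u - trunc T u) k = coef u k - coef (trunc T u) k := by
    simp [coef_eq_inner, inner_sub_right]
  rw [this, coef_trunc]
  split_ifs <;> simp

/-- The characters of eigenvalue at most `N` lie in the range of `P N`. They in fact span it, but
only this inclusion is needed, since the norm of `P N (v 0)` has to be bounded from below. -/
lemma chiLp_mem_lowModes {N : ℕ} {k : Fin 3 → ℤ} (hk : freqSq k ≤ N) : chiLp k ∈ lowModes N := by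
  refine Submodule.smul_mem _ _ (Submodule.le_topologicalClosure _ (Submodule.subset_span ?_))
  refine ⟨chi k, freqSq k, isSmooth_chi k, by exact_mod_cast hk, fun y => ?_,
    ContinuousMap.coeFn_toLp volume (chi k)⟩
  rw [torusLaplacian_chi]; push_cast; ring

lemma energy_le_norm_P_sq {N : ℕ} {T : Finset (Fin 3 → ℤ)} (hT : ∀ k ∈ T, freqSq k ≤ N) (u : H) :
    energy T u ≤ ‖P N u‖ ^ 2 := by
  have : energy T u = energy T (P N u) := by
    refine Finset.sum_congr rfl fun k hk => ?_
    have h := Submodule.inner_starProjection_left_eq_right (lowModes N) (chiLp k) u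
    rw [coef_eq_inner, coef_eq_inner, P, ← h,
      Submodule.starProjection_eq_self_iff.2 (chiLp_mem_lowModes (hT k hk))]
  rw [this]
  exact energy_le T _

/-! ### Multiplication operators and their Fourier coefficients -/

lemma memLp_reaction (p q : C(Torus, ℂ)) (u : H) :
    MemLp (fun x => p x * u x + q x * conj (u x)) 2 (volume : Measure Torus) := by
  have hu := Lp.aestronglyMeasurable u
  refine (Lp.memLp u).of_le_mul (c := ‖p‖ + ‖q‖) ?_ (ae_of_all _ fun x => ?_)
  · exact (p.continuous.aestronglyMeasurable.mul hu).add
      (q.continuous.aestronglyMeasurable.mul (Complex.continuous_conj.comp_aestronglyMeasurable hu))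
  · refine (norm_add_le _ _).trans ?_
    rw [norm_mul, norm_mul, RCLike.norm_conj, add_mul]
    gcongr
    · exact p.norm_coe_le_norm x
    · exact q.norm_coe_le_norm x

/-- The lower order term `p u + q ū` of the equation, as an element of `H`. -/
def reaction (p q : C(Torus, ℂ)) (u : H) : H := (memLp_reaction p q u).toLp

lemma coeFn_reaction (p q : C(Torus, ℂ)) (u : H) :
    reaction p q u =ᵐ[volume] fun x => p x * u x + q x * conj (u x) :=
  (memLp_reaction p q u).coeFn_toLp

lemma norm_reaction_le {p q : C(Torus, ℂ)} {C : ℝ} (h : ∀ x, ‖p x‖ + ‖q x‖ ≤ C) (u : H) :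
    ‖reaction p q u‖ ≤ C * ‖u‖ := by
  refine Lp.norm_le_mul_norm_of_ae_le_mul ?_
  filter_upwards [coeFn_reaction p q u] with x hx
  rw [hx]
  refine (norm_add_le _ _).trans ?_
  rw [norm_mul, norm_mul, RCLike.norm_conj, ← add_mul]
  exact mul_le_mul_of_nonneg_right (h x) (norm_nonneg _)

lemma reaction_add (p q : C(Torus, ℂ)) (u w : H) :
    reaction p q (u + w) = reaction p q u + reaction p q w := by
  refine Lp.ext ?_
  filter_upwards [coeFn_reaction p q (u + w), coeFn_reaction p q u, coeFn_reaction p q w,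
    Lp.coeFn_add u w, Lp.coeFn_add (reaction p q u) (reaction p q w)] with x h1 h2 h3 h4 h5
  rw [h1, h5, Pi.add_apply, h2, h3, h4, Pi.add_apply, map_add]
  ring

lemma add_reaction (p p' q q' : C(Torus, ℂ)) (u : H) :
    reaction (p + p') (q + q') u = reaction p q u + reaction p' q' u := by
  refine Lp.ext ?_
  filter_upwards [coeFn_reaction (p + p') (q + q') u, coeFn_reaction p q u, coeFn_reaction p' q' u,
    Lp.coeFn_add (reaction p q u) (reaction p' q' u)] with x h1 h2 h3 h4
  rw [h1, h4, Pi.add_apply, h2, h3, ContinuousMap.add_apply, ContinuousMap.add_apply]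
  ring

lemma smul_reaction (c : ℂ) (p q : C(Torus, ℂ)) (u : H) :
    reaction (c • p) (c • q) u = c • reaction p q u := by
  refine Lp.ext ?_
  filter_upwards [coeFn_reaction (c • p) (c • q) u, coeFn_reaction p q u,
    Lp.coeFn_smul c (reaction p q u)] with x h1 h2 h3
  rw [h1, h3, Pi.smul_apply, h2, ContinuousMap.smul_apply, ContinuousMap.smul_apply]
  simp only [smul_eq_mul]
  ring

lemma coef_reaction (p q : C(Torus, ℂ)) (u : H) (k : Fin 3 → ℤ) : coef (reaction p q u) k =
    normConst * ∫ x, (p x * u x + q x * conj (u x)) * chi (-k) x := by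
  rw [coef_eq_integral]
  congr 1
  refine integral_congr_ae ?_
  filter_upwards [coeFn_reaction p q u] with x hx
  rw [hx]

lemma coef_reaction_chi_left (m : Fin 3 → ℤ) (u : H) (k : Fin 3 → ℤ) :
    coef (reaction (chi m) 0 u) k = coef u (k - m) := by
  rw [coef_reaction, coef_eq_integral]
  congr 2
  ext x
  rw [neg_sub, sub_eq_add_neg, chi_add, ContinuousMap.zero_apply]
  ring

lemma coef_reaction_chi_right (m : Fin 3 → ℤ) (u : H) (k : Fin 3 → ℤ) :
    coef (reaction 0 (chi m) u) k = conj (coef u (m - k)) := by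
  rw [coef_reaction, coef_eq_integral, map_mul, Complex.conj_ofReal, ← integral_conj]
  congr 2
  ext x
  rw [map_mul, ← chi_neg, neg_neg, sub_eq_add_neg, chi_add, ContinuousMap.zero_apply]
  ring

/-- Trigonometric polynomials of mean zero and degree at most `√R`. -/
def oscPoly (R : ℕ) : Submodule ℂ C(Torus, ℂ) :=
  Submodule.span ℂ (chi '' {m | m ≠ 0 ∧ freqSq m ≤ R})

lemma oscPoly_mono {R R' : ℕ} (h : R ≤ R') : oscPoly R ≤ oscPoly R' :=
  Submodule.span_mono (image_mono fun _ hm => ⟨hm.1, hm.2.trans (by exact_mod_cast h)⟩)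

/-- Multiplication by a mean-zero trigonometric polynomial of low degree does not couple the
frequencies of a set `B` whose points are far apart. -/
lemma coef_reaction_oscPoly {B : Finset (Fin 3 → ℤ)} {R : ℕ} (hneg : ∀ k ∈ B, -k ∈ B)
    (hB : ∀ k ∈ B, ∀ l ∈ B, k ≠ l → (R : ℤ) < freqSq (k - l)) {u : H}
    (hu : ∀ l, l ∉ B → coef u l = 0) {p q : C(Torus, ℂ)} (hp : p ∈ oscPoly R)
    (hq : q ∈ oscPoly R) {k : Fin 3 → ℤ} (hk : k ∈ B) : coef (reaction p q u) k = 0 := by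
  have hfar : ∀ m : Fin 3 → ℤ, m ≠ 0 → freqSq m ≤ R → k - m ∉ B := fun m hm hmR hkm => by
    have := hB k hk _ hkm fun h => hm (sub_eq_self.1 h.symm)
    rw [sub_sub_cancel] at this
    omega
  have h0 : coef (reaction 0 0 u) k = 0 := by simp [coef_reaction]
  have hl : coef (reaction p 0 u) k = 0 := by
    induction hp using Submodule.span_induction with
    | mem x hx =>
      obtain ⟨m, ⟨hm, hmR⟩, rfl⟩ := hx
      rw [coef_reaction_chi_left, hu _ (hfar m hm hmR)]
    | zero => exact h0
    | add x y _ _ hx hy =>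
      rw [← add_zero (0 : C(Torus, ℂ)), add_reaction, coef_add, hx, hy, add_zero]
    | smul c x _ hx =>
      rw [← smul_zero c, smul_reaction, coef, map_smul, lp.coeFn_smul, Pi.smul_apply, ← coef, hx,
        smul_zero]
  have hr : coef (reaction 0 q u) k = 0 := by
    induction hq using Submodule.span_induction with
    | mem x hx =>
      obtain ⟨m, ⟨hm, hmR⟩, rfl⟩ := hx
      have : m - k ∉ B := fun h => hfar m hm hmR (by simpa using hneg _ h)
      rw [coef_reaction_chi_right, hu _ this, map_zero]
    | zero => exact h0
    | add x y _ _ hx hy =>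
      rw [← add_zero (0 : C(Torus, ℂ)), add_reaction, coef_add, hx, hy, add_zero]
    | smul c x _ hx =>
      rw [← smul_zero c, smul_reaction, coef, map_smul, lp.coeFn_smul, Pi.smul_apply, ← coef, hx,
        smul_zero]
  have := add_reaction p 0 0 q u
  rw [add_zero, zero_add] at this
  rw [this, coef_add, hl, hr, add_zero]

/-! ### Uniform trigonometric approximation of the coefficients -/

/-- The mean value over the torus. -/
def mean : C(Torus, ℂ) →ₗ[ℂ] ℂ where
  toFun g := (normConst : ℂ) ^ 2 * ∫ x, g x
  map_add' g h := by
    have hi : ∀ g : C(Torus, ℂ), Integrable g (volume : Measure Torus) := fun g =>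
      g.continuous.integrable_of_hasCompactSupport (HasCompactSupport.of_compactSpace _)
    simp only [ContinuousMap.add_apply]
    rw [integral_add (hi g) (hi h), mul_add]
  map_smul' c g := by
    simp only [ContinuousMap.smul_apply, smul_eq_mul, RingHom.id_apply, integral_const_mul]
    ring

lemma mean_apply (g : C(Torus, ℂ)) : mean g = (normConst : ℂ) ^ 2 * ∫ x, g x := rfl

lemma mean_chi (k : Fin 3 → ℤ) : mean (chi k) = if k = 0 then 1 else 0 := by
  have h := normConst_sq
  have h' : (normConst : ℂ) ^ 2 * (2 * π) ^ 3 = 1 := by exact_mod_cast h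
  rw [mean_apply, integral_chi]
  split_ifs <;> simp [h']

lemma norm_mean_integral_le {f : Torus → ℂ} {C : ℝ} (h : ∀ x, ‖f x‖ ≤ C) :
    ‖(normConst : ℂ) ^ 2 * ∫ x, f x‖ ≤ C := by
  have h1 := norm_integral_le_of_norm_le_const (μ := (volume : Measure Torus)) (ae_of_all _ h)
  rw [volume_real_torus] at h1
  rw [norm_mul, norm_pow, Complex.norm_real, Real.norm_of_nonneg normConst_pos.le]
  calc normConst ^ 2 * ‖∫ x, f x‖ ≤ normConst ^ 2 * (C * (2 * π) ^ 3) := by gcongr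
    _ = C := by linear_combination C * normConst_sq

lemma norm_mean_le {g : C(Torus, ℂ)} {C : ℝ} (h : ∀ x, ‖g x‖ ≤ C) : ‖mean g‖ ≤ C :=
  norm_mean_integral_le h

/-- The oscillating part `g - mean g` of a function. -/
def fluct : C(Torus, ℂ) →ₗ[ℂ] C(Torus, ℂ) := LinearMap.id - mean.smulRight 1

lemma fluct_apply (g : C(Torus, ℂ)) : fluct g = g - mean g • 1 := rfl

lemma norm_fluct_le (g : C(Torus, ℂ)) : ‖fluct g‖ ≤ 2 * ‖g‖ := by
  have h := norm_mean_le g.norm_coe_le_norm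
  have h1 : ‖(1 : C(Torus, ℂ))‖ = 1 := norm_one
  rw [fluct_apply]
  refine (norm_sub_le _ _).trans ?_
  rw [norm_smul, h1]
  linarith

lemma exists_fluct_mem_oscPoly {p : C(Torus, ℂ)} (hp : p ∈ Submodule.span ℂ (range chi)) :
    ∃ R : ℕ, fluct p ∈ oscPoly R := by
  induction hp using Submodule.span_induction with
  | mem x hx =>
    obtain ⟨m, rfl⟩ := hx
    by_cases hm : m = 0
    · have : fluct (chi m) = 0 := by rw [fluct_apply, mean_chi, hm, chi_zero]; simp
      exact ⟨0, by rw [this]; exact zero_mem _⟩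
    · refine ⟨(freqSq m).toNat, ?_⟩
      have : fluct (chi m) = chi m := by simp [fluct_apply, mean_chi, hm]
      rw [this]
      exact Submodule.subset_span ⟨m, ⟨hm, by have := freqSq_nonneg m; omega⟩, rfl⟩
  | zero => exact ⟨0, by simp⟩
  | add x y _ _ hx hy =>
    obtain ⟨R, hR⟩ := hx
    obtain ⟨R', hR'⟩ := hy
    refine ⟨max R R', ?_⟩
    rw [map_add]
    exact add_mem (oscPoly_mono (le_max_left _ _) hR) (oscPoly_mono (le_max_right _ _) hR')
  | smul c x _ hx =>
    obtain ⟨R, hR⟩ := hx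
    exact ⟨R, by rw [map_smul]; exact Submodule.smul_mem _ _ hR⟩

/-- On a totally bounded set of functions, the degree of the approximating trigonometric
polynomials can be chosen uniformly. -/
lemma exists_uniform_oscPoly {F : Set C(Torus, ℂ)} (hF : TotallyBounded F) {ε : ℝ} (hε : 0 < ε) :
    ∃ R : ℕ, ∀ g ∈ F, ∃ p ∈ oscPoly R, ‖fluct g - p‖ ≤ ε := by
  have hdense : ∀ g : C(Torus, ℂ), ∃ p ∈ Submodule.span ℂ (range chi), dist g p < ε / 4 :=
    fun g => by
      have hg : g ∈ (Submodule.span ℂ (range chi)).topologicalClosure := by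
        rw [span_chi_closure_eq_top]; trivial
      exact Metric.mem_closure_iff.1 hg _ (by positivity)
  choose p hp hgp using hdense
  choose r hr using fun g => exists_fluct_mem_oscPoly (hp g)
  obtain ⟨t, ht, hFt⟩ := Metric.totallyBounded_iff.1 hF (ε / 4) (by positivity)
  refine ⟨ht.toFinset.sup r, fun g hg => ?_⟩
  obtain ⟨y, hy, hgy⟩ := mem_iUnion₂.1 (hFt hg)
  refine ⟨fluct (p y), oscPoly_mono (Finset.le_sup (ht.mem_toFinset.2 hy)) (hr y), ?_⟩
  rw [← map_sub]
  refine (norm_fluct_le _).trans ?_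
  have h1 : ‖g - p y‖ ≤ dist g y + dist y (p y) := by
    rw [← dist_eq_norm]; exact dist_triangle _ _ _
  have h2 := Metric.mem_ball.1 hgy
  have h3 := hgp y
  linarith

lemma continuous_proj : Continuous proj := by
  unfold proj; fun_prop

lemma isOpenMap_proj : IsOpenMap proj := by
  have h1 : IsOpenMap (Pi.map fun (_ : Fin 3) (x : ℝ) => (x : AddCircle (2 * π))) :=
    IsOpenMap.piMap (fun _ => QuotientAddGroup.isOpenMap_coe)
      (Filter.Eventually.of_forall fun _ => QuotientAddGroup.mk_surjective)
  exact h1.comp (EuclideanSpace.equiv (Fin 3) ℝ).toHomeomorph.isOpenMap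

lemma surjective_proj : Function.Surjective proj := fun y => by
  choose x hx using fun i => QuotientAddGroup.mk_surjective (y i)
  exact ⟨WithLp.toLp 2 x, funext hx⟩

lemma isQuotientMap_proj : Topology.IsQuotientMap proj :=
  isOpenMap_proj.isQuotientMap continuous_proj surjective_proj

/-- Functions on the torus that are bounded by `K` and, read on `ℝ³`, `K`-Lipschitz. -/
def lipBall (K : ℝ) : Set C(Torus, ℂ) :=
  {g | (∀ x, ‖g x‖ ≤ K) ∧ ∀ x y : Space, ‖g (proj x) - g (proj y)‖ ≤ K * ‖x - y‖}

lemma totallyBounded_lipBall (K : ℝ) : TotallyBounded (lipBall K) := by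
  let e := ContinuousMap.isometryEquivBoundedOfCompact Torus ℂ
  have hK : IsCompact (closure (e '' lipBall K)) := by
    refine BoundedContinuousFunction.arzela_ascoli (Metric.closedBall 0 K)
      (isCompact_closedBall 0 K) _ ?_ ?_
    · rintro _ x ⟨g, hg, rfl⟩
      simpa [e] using hg.1 x
    · intro y
      obtain ⟨x, rfl⟩ := surjective_proj y
      rw [Metric.equicontinuousAt_iff]
      intro ε hε
      have hnhds : proj '' Metric.ball x (ε / (|K| + 1)) ∈ nhds (proj x) :=
        isOpenMap_proj.image_mem_nhds (Metric.ball_mem_nhds x (by positivity))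
      obtain ⟨δ, hδ, hball⟩ := Metric.mem_nhds_iff.1 hnhds
      refine ⟨δ, hδ, fun z hz => ?_⟩
      obtain ⟨w, hw, rfl⟩ := hball hz
      rintro ⟨_, g, hg, rfl⟩
      have h1 := hg.2 x w
      rw [Metric.mem_ball, dist_comm, dist_eq_norm, lt_div_iff₀ (by positivity)] at hw
      have : K * ‖x - w‖ ≤ |K| * ‖x - w‖ := by gcongr; exact le_abs_self K
      calc dist (e g (proj x)) (e g (proj w)) = ‖g (proj x) - g (proj w)‖ := dist_eq_norm _ _
        _ ≤ |K| * ‖x - w‖ := h1.trans this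
        _ < ε := by nlinarith [norm_nonneg (x - w)]
  have h2 : TotallyBounded (e '' lipBall K) := hK.totallyBounded.subset subset_closure
  have h3 := h2.image e.symm.isometry.uniformContinuous
  simpa [image_image] using h3

/-! ### Consequences of the `C¹` bound on the coefficients -/

/-- The function `a(t, ·)` on the torus. -/
def slice {a : ℝ → Torus → ℂ} (ha : ContDiff ℝ 1 (lift a)) (t : ℝ) : C(Torus, ℂ) where
  toFun := a t
  continuous_toFun := by
    rw [isQuotientMap_proj.continuous_iff]
    exact ha.continuous.comp (continuous_const.prodMk continuous_id)

lemma slice_apply {a : ℝ → Torus → ℂ} (ha : ContDiff ℝ 1 (lift a)) (t : ℝ) (x : Torus) :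
    slice ha t x = a t x := rfl

lemma CoeffBound.norm_add_norm_le {K : ℝ≥0} {a b : ℝ → Torus → ℂ} (h : CoeffBound K a b) (t : ℝ)
    (x : Torus) : ‖a t x‖ + ‖b t x‖ ≤ K := by
  obtain ⟨y, rfl⟩ := surjective_proj x
  have hle : ∀ a : ℝ → Torus → ℂ, ‖a t (proj y)‖ₑ ≤ c1Norm a := fun a =>
    (le_iSup (fun p : ℝ × Space => ‖lift a p‖ₑ) (t, y)).trans le_self_add
  have h1 := (add_le_add (hle a) (hle b)).trans h.bound
  rw [enorm_eq_nnnorm, enorm_eq_nnnorm] at h1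
  exact_mod_cast h1

lemma norm_fderiv_lift_le {K : ℝ≥0} {a : ℝ → Torus → ℂ} (h : c1Norm a ≤ K) (p : ℝ × Space) :
    ‖fderiv ℝ (lift a) p‖ ≤ K := by
  have h1 := (le_iSup (fun p : ℝ × Space => ‖fderiv ℝ (lift a) p‖ₑ) p).trans (le_add_self.trans h)
  rw [enorm_eq_nnnorm] at h1
  exact_mod_cast h1

lemma norm_apply_le {K : ℝ≥0} {a : ℝ → Torus → ℂ} (h : c1Norm a ≤ K) (t : ℝ) (x : Torus) :
    ‖a t x‖ ≤ K := by
  obtain ⟨y, rfl⟩ := surjective_proj x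
  have h1 := ((le_iSup (fun p : ℝ × Space => ‖lift a p‖ₑ) (t, y)).trans le_self_add).trans h
  rw [enorm_eq_nnnorm] at h1
  exact_mod_cast h1

lemma slice_mem_lipBall {K : ℝ≥0} {a : ℝ → Torus → ℂ} (ha : ContDiff ℝ 1 (lift a))
    (h : c1Norm a ≤ K) (t : ℝ) : slice ha t ∈ lipBall K := by
  refine ⟨fun x => norm_apply_le h t x, fun x y => ?_⟩
  have := convex_univ.norm_image_sub_le_of_norm_fderiv_le (𝕜 := ℝ) (f := lift a) (C := K)
    (x := (t, y)) (y := (t, x)) (fun p _ => ha.differentiable (by simp) p)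
    (fun p _ => norm_fderiv_lift_le h p) (mem_univ _) (mem_univ _)
  simpa [lift, slice_apply] using this

lemma norm_mean_slice_le {K : ℝ≥0} {a : ℝ → Torus → ℂ} (ha : ContDiff ℝ 1 (lift a))
    (h : c1Norm a ≤ K) (t : ℝ) : ‖mean (slice ha t)‖ ≤ K :=
  norm_mean_le fun x => norm_apply_le h t x

/-- The spatial mean of a coefficient is a differentiable function of time. -/
lemma exists_hasDerivAt_mean_slice {K : ℝ≥0} {a : ℝ → Torus → ℂ} (ha : ContDiff ℝ 1 (lift a))
    (h : c1Norm a ≤ K) (t : ℝ) :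
    ∃ d : ℂ, HasDerivAt (fun s => mean (slice ha s)) d t ∧ ‖d‖ ≤ K := by
  have hder : ∀ (s : ℝ) (y : Space), HasDerivAt (fun r => a r (proj y))
      (fderiv ℝ (lift a) (s, y) (1, 0)) s := fun s y => by
    have h1 := (ha.differentiable (by simp) (s, y)).hasFDerivAt.comp_hasDerivAt s
      ((hasDerivAt_id s).prodMk (hasDerivAt_const s y))
    exact h1
  have hderiv : ∀ (s : ℝ) (x : Torus), HasDerivAt (fun r => a r x) (deriv (fun r => a r x) s) s :=
    fun s x => by
      obtain ⟨y, rfl⟩ := surjective_proj x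
      exact (hder s y).differentiableAt.hasDerivAt
  have hbound : ∀ (s : ℝ) (x : Torus), ‖deriv (fun r => a r x) s‖ ≤ K := fun s x => by
    obtain ⟨y, rfl⟩ := surjective_proj x
    rw [(hder s y).deriv]
    refine ((fderiv ℝ (lift a) (s, y)).le_opNorm _).trans ?_
    have : ‖((1 : ℝ), (0 : Space))‖ = 1 := by simp [Prod.norm_def]
    rw [this, mul_one]
    exact norm_fderiv_lift_le h _
  have hcont : Continuous fun x : Torus => deriv (fun r => a r x) t := by
    rw [isQuotientMap_proj.continuous_iff]
    have : (fun x : Torus => deriv (fun r => a r x) t) ∘ proj =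
        fun y : Space => fderiv ℝ (lift a) (t, y) (1, 0) := funext fun y => (hder t y).deriv
    rw [this]
    exact ((ha.continuous_fderiv (by simp)).comp
      (continuous_const.prodMk continuous_id)).clm_apply continuous_const
  have key := (hasDerivAt_integral_of_dominated_loc_of_deriv_le
    (μ := (volume : Measure Torus)) (F := fun s x => a s x)
    (F' := fun s x => deriv (fun r => a r x) s) (x₀ := t) (s := univ) (bound := fun _ => (K : ℝ))
    Filter.univ_mem
    (Filter.Eventually.of_forall fun s => (slice ha s).continuous.aestronglyMeasurable)
    ((slice ha t).continuous.integrable_of_hasCompactSupport (HasCompactSupport.of_compactSpace _))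
    hcont.aestronglyMeasurable (ae_of_all _ fun x s _ => hbound s x) (integrable_const _)
    (ae_of_all _ fun x s _ => hderiv s x)).2
  exact ⟨_, key.const_mul ((normConst : ℂ) ^ 2), norm_mean_integral_le (hbound t)⟩

/-! ### The quadratic Lyapunov functional -/

/-- The finite set of frequencies with `|k|² ≤ n`. -/
def freqBall (n : ℕ) : Finset (Fin 3 → ℤ) :=
  (Fintype.piFinset fun _ => Finset.Icc (-(n : ℤ)) n).filter fun k => freqSq k ≤ n

lemma mem_freqBall {n : ℕ} {k : Fin 3 → ℤ} : k ∈ freqBall n ↔ freqSq k ≤ n := by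
  simp only [freqBall, Finset.mem_filter, Fintype.mem_piFinset, Finset.mem_Icc, ← abs_le,
    and_iff_right_iff_imp]
  intro h i
  have h1 : k i ^ 2 ≤ freqSq k :=
    Finset.single_le_sum (f := fun i => k i ^ 2) (fun i _ => sq_nonneg (k i)) (Finset.mem_univ i)
  have h2 : |k i| ≤ k i ^ 2 := by
    rw [← sq_abs]; exact Int.le_self_sq _
  omega

/-- The finite set of frequencies with `N - κ ≤ |k|² ≤ N + κ`. -/
def band (N κ : ℕ) : Finset (Fin 3 → ℤ) := (freqBall (N + κ)).filter fun k => N - κ ≤ freqSq k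

lemma mem_band {N κ : ℕ} {k : Fin 3 → ℤ} : k ∈ band N κ ↔ |freqSq k - N| ≤ κ := by
  rw [band, Finset.mem_filter, mem_freqBall, abs_le]
  push_cast
  omega

lemma neg_mem_band {N κ : ℕ} {k : Fin 3 → ℤ} (hk : k ∈ band N κ) : -k ∈ band N κ := by
  rwa [mem_band, freqSq_neg, ← mem_band]

lemma band_subset {N κ n : ℕ} (h : N + κ ≤ n) : band N κ ⊆ freqBall n := fun k hk => by
  rw [band, Finset.mem_filter, mem_freqBall] at hk
  rw [mem_freqBall]
  omega

lemma sum_band_neg {M : Type*} [AddCommMonoid M] {N κ : ℕ} (f : (Fin 3 → ℤ) → M) :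
    ∑ k ∈ band N κ, f (-k) = ∑ k ∈ band N κ, f k :=
  Finset.sum_nbij' (fun k => -k) (fun k => -k) (fun _ => neg_mem_band) (fun _ => neg_mem_band)
    (by simp) (by simp) (by simp)

/-- The sign `-1` on the modes below the cut `N`, `+1` above it. -/
def cutSign (N : ℕ) (k : Fin 3 → ℤ) : ℝ := if freqSq k ≤ N then -1 else 1

lemma abs_cutSign (N : ℕ) (k : Fin 3 → ℤ) : |cutSign N k| = 1 := by
  rw [cutSign]; split_ifs <;> simp

lemma cutSign_mul_le (N : ℕ) (k : Fin 3 → ℤ) :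
    cutSign N k * (2 * N + 1 - 2 * freqSq k) ≤ -1 := by
  rw [cutSign]
  split_ifs with h
  · have : (freqSq k : ℝ) ≤ N := by exact_mod_cast h
    linarith
  · have : (N : ℝ) + 1 ≤ freqSq k := by exact_mod_cast not_le.1 h
    linarith

lemma cutSign_mul_le_of_notMem_band {N κ : ℕ} {k : Fin 3 → ℤ} (hk : k ∉ band N κ) :
    cutSign N k * (2 * N + 1 - 2 * freqSq k) ≤ -(2 * κ + 1) := by
  rw [mem_band, abs_le] at hk
  rw [cutSign]
  split_ifs with h
  · have h1 : freqSq k + κ + 1 ≤ N := by omega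
    have : (freqSq k : ℝ) + κ + 1 ≤ N := by exact_mod_cast h1
    linarith
  · have h1 : (N : ℤ) + κ + 1 ≤ freqSq k := by omega
    have : (N : ℝ) + κ + 1 ≤ freqSq k := by exact_mod_cast h1
    linarith

/-- The indefinite form `‖(1 - P_N) u‖² - ‖P_N u‖²`, truncated to the modes with `|k|² ≤ n`. Here
`P_N` is read as the projection onto the characters with `|k|² ≤ N`, so that the form is an explicit
finite sum. -/
def coneForm (N n : ℕ) (u : H) : ℝ := ∑ k ∈ freqBall n, cutSign N k * ‖coef u k‖ ^ 2

/-- The resonant quantity `∑ ± u_k u_{-k}` over the band, through which the mean of `b` acts. It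
rotates with the large frequency `2 ω N`. -/
def resonance (N κ : ℕ) (u : H) : ℂ :=
  ∑ k ∈ band N κ, cutSign N k * (coef u k * coef u (-k))

lemma norm_resonance_le (N κ : ℕ) (u : H) : ‖resonance N κ u‖ ≤ energy (band N κ) u := by
  have h1 : ‖resonance N κ u‖ ≤
      ∑ k ∈ band N κ, (‖coef u k‖ ^ 2 / 2 + ‖coef u (-k)‖ ^ 2 / 2) := by
    refine norm_sum_le_of_le _ fun k _ => ?_
    rw [norm_mul, Complex.norm_real, Real.norm_eq_abs, abs_cutSign, one_mul, norm_mul]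
    nlinarith [sq_nonneg (‖coef u k‖ - ‖coef u (-k)‖)]
  rw [Finset.sum_add_distrib, sum_band_neg (fun k => ‖coef u k‖ ^ 2 / 2), ← Finset.sum_div] at h1
  exact h1.trans (by rw [energy]; linarith)

lemma neg_two_re_le {s η : ℝ} (hs : |s| = 1) (hη : 0 < η) (z w : ℂ) :
    -2 * (s * (conj z * w)).re ≤ η * ‖z‖ ^ 2 + η⁻¹ * ‖w‖ ^ 2 := by
  have h1 : |(s * (conj z * w)).re| ≤ ‖z‖ * ‖w‖ := by
    refine (Complex.abs_re_le_norm _).trans ?_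
    rw [norm_mul, norm_mul, RCLike.norm_conj, Complex.norm_real, Real.norm_eq_abs, hs, one_mul]
  have h2 : η * ‖z‖ ^ 2 + η⁻¹ * ‖w‖ ^ 2 - 2 * (‖z‖ * ‖w‖) = η⁻¹ * (η * ‖z‖ - ‖w‖) ^ 2 := by
    field_simp
    ring
  have h3 : 0 ≤ η⁻¹ * (η * ‖z‖ - ‖w‖) ^ 2 := by positivity
  linarith [neg_abs_le (s * (conj z * w)).re]

section FixedTime

variable {N κ n : ℕ} {ω K δ : ℝ} {u F g h : H} {m m' γ γ' : ℂ} {d : (Fin 3 → ℤ) → ℂ}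

/-- Decay of the indefinite form, up to the resonant contribution of the mean `m'` of `b`. -/
lemma coneForm_deriv_le (hn : N + κ ≤ n) (hm : ‖m‖ ≤ K) (hF : ‖F‖ ≤ K * ‖u‖)
    (hg : ‖g‖ ≤ (1 / 16) * ‖trunc (band N κ) u‖) (hh : ‖h‖ ≤ K * ‖u - trunc (band N κ) u‖)
    (hband : ∀ k ∈ band N κ, coef F k =
      m * coef u k + m' * conj (coef u (-k)) + coef g k + coef h k)
    (hd : ∀ k, d k = -((1 + Complex.I * ω) * freqSq k) * coef u k - coef F k) :
    ∑ k ∈ freqBall n, cutSign N k * (2 * (conj (coef u k) * d k).re)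
        + 2 * (N + 1 / 2 + m.re) * coneForm N n u ≤
      -(5 / 8) * energy (band N κ) u
        - (2 * κ - 2 * K - 16 * K ^ 2 - 1 / 8) * energy (freqBall n \ band N κ) u
        + (8 * K ^ 2 + 1 / 8) * (‖u‖ ^ 2 - energy (freqBall n) u)
        - 2 * (m' * conj (resonance N κ u)).re := by
  have hre := Complex.abs_re_le_norm m
  set X := energy (band N κ) u with hX
  set Y := energy (freqBall n \ band N κ) u with hY
  have hXY : Y + X = energy (freqBall n) u := Finset.sum_sdiff (band_subset hn)
  have hsq : ∀ k, (conj (coef u k) * coef u k).re = ‖coef u k‖ ^ 2 := fun k => by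
    rw [Complex.conj_mul', ← Complex.ofReal_pow, Complex.ofReal_re]
  have hterm : ∀ k, cutSign N k * (2 * (conj (coef u k) * d k).re)
      + 2 * (N + 1 / 2 + m.re) * (cutSign N k * ‖coef u k‖ ^ 2) =
      cutSign N k * (2 * N + 1 - 2 * freqSq k) * ‖coef u k‖ ^ 2
        + 2 * (m.re * cutSign N k) * ‖coef u k‖ ^ 2
        - 2 * (cutSign N k * (conj (coef u k) * coef F k)).re := fun k => by
    have h1 : (conj (coef u k) * d k).re =
        -(freqSq k) * ‖coef u k‖ ^ 2 - (conj (coef u k) * coef F k).re := by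
      have h2 : conj (coef u k) * d k = ((-(freqSq k : ℝ) : ℝ) : ℂ) * (conj (coef u k) * coef u k)
          + ((-(ω * freqSq k * ‖coef u k‖ ^ 2 : ℝ) : ℝ) : ℂ) * Complex.I
          - conj (coef u k) * coef F k := by
        rw [hd]
        push_cast
        rw [← Complex.conj_mul']
        ring
      rw [h2, Complex.sub_re, Complex.add_re, Complex.re_ofReal_mul, hsq, Complex.re_ofReal_mul,
        Complex.I_re]
      ring
    rw [h1, Complex.re_ofReal_mul]
    ring
  have hout : ∑ k ∈ freqBall n \ band N κ, (cutSign N k * (2 * (conj (coef u k) * d k).re)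
      + 2 * (N + 1 / 2 + m.re) * (cutSign N k * ‖coef u k‖ ^ 2)) ≤
      (-(2 * κ + 1) + 2 * K + (8 * K ^ 2 + 1)) * Y + ‖u‖ ^ 2 / 8 := by
    calc _ ≤ ∑ k ∈ freqBall n \ band N κ,
          ((-(2 * κ + 1) + 2 * K + (8 * K ^ 2 + 1)) * ‖coef u k‖ ^ 2
            + (8 * K ^ 2 + 1)⁻¹ * ‖coef F k‖ ^ 2) := by
          refine Finset.sum_le_sum fun k hk => ?_
          rw [hterm]
          have h1 := cutSign_mul_le_of_notMem_band (Finset.mem_sdiff.1 hk).2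
          have h2 := neg_two_re_le (abs_cutSign N k) (η := 8 * K ^ 2 + 1) (by positivity)
            (coef u k) (coef F k)
          have h3 : m.re * cutSign N k ≤ K := by
            refine (le_abs_self _).trans ?_
            rw [abs_mul, abs_cutSign, mul_one]; exact hre.trans hm
          have h4 := sq_nonneg ‖coef u k‖
          nlinarith [mul_le_mul_of_nonneg_right h1 h4, mul_le_mul_of_nonneg_right h3 h4]
      _ ≤ _ := by
          rw [Finset.sum_add_distrib, ← Finset.mul_sum, ← Finset.mul_sum]
          have h1 := (energy_le (freqBall n \ band N κ) F).trans
            (pow_le_pow_left₀ (norm_nonneg _) hF 2)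
          have h2 : (8 * K ^ 2 + 1)⁻¹ * energy (freqBall n \ band N κ) F ≤ ‖u‖ ^ 2 / 8 := by
            rw [inv_mul_le_iff₀ (by positivity)]
            nlinarith [sq_nonneg ‖u‖]
          rw [energy] at h2
          rw [hY, energy]
          linarith
  have hin : ∑ k ∈ band N κ, (cutSign N k * (2 * (conj (coef u k) * d k).re)
      + 2 * (N + 1 / 2 + m.re) * (cutSign N k * ‖coef u k‖ ^ 2)) ≤
      -(3 / 4) * X + 8 * K ^ 2 * (‖u‖ ^ 2 - X) - 2 * (m' * conj (resonance N κ u)).re := by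
    calc _ ≤ ∑ k ∈ band N κ, (-(13 / 16) * ‖coef u k‖ ^ 2 + 16 * ‖coef g k‖ ^ 2
            + 8 * ‖coef h k‖ ^ 2
            - 2 * (m' * conj (cutSign N k * (coef u k * coef u (-k)) : ℂ)).re) := by
          refine Finset.sum_le_sum fun k hk => ?_
          rw [hterm]
          have h1 := mul_le_mul_of_nonneg_right (cutSign_mul_le N k) (sq_nonneg ‖coef u k‖)
          have h2 := neg_two_re_le (abs_cutSign N k) (η := 1 / 16) (by positivity)
            (coef u k) (coef g k)
          have h3 := neg_two_re_le (abs_cutSign N k) (η := 1 / 8) (by positivity)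
            (coef u k) (coef h k)
          have h4 : (cutSign N k * (conj (coef u k) * coef F k) : ℂ).re =
              m.re * cutSign N k * ‖coef u k‖ ^ 2
              + (m' * conj (cutSign N k * (coef u k * coef u (-k)) : ℂ)).re
              + (cutSign N k * (conj (coef u k) * coef g k) : ℂ).re
              + (cutSign N k * (conj (coef u k) * coef h k) : ℂ).re := by
            have h5 : (cutSign N k * (conj (coef u k) * coef F k) : ℂ) =
                ((cutSign N k * ‖coef u k‖ ^ 2 : ℝ) : ℂ) * m
                + m' * conj (cutSign N k * (coef u k * coef u (-k)) : ℂ)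
                + (cutSign N k * (conj (coef u k) * coef g k) : ℂ)
                + (cutSign N k * (conj (coef u k) * coef h k) : ℂ) := by
              rw [hband k hk]
              push_cast
              rw [← Complex.conj_mul', map_mul, map_mul, Complex.conj_ofReal]
              ring
            rw [h5, Complex.add_re, Complex.add_re, Complex.add_re, Complex.re_ofReal_mul]
            ring
          rw [show (1 / 16 : ℝ)⁻¹ = 16 by norm_num] at h2
          rw [show (1 / 8 : ℝ)⁻¹ = 8 by norm_num] at h3
          rw [h4]
          linarith
      _ ≤ _ := by
          have h1 : ∑ k ∈ band N κ,
              (m' * conj (cutSign N k * (coef u k * coef u (-k)) : ℂ)).re =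
              (m' * conj (resonance N κ u)).re := by
            rw [resonance, map_sum, Finset.mul_sum, Complex.re_sum]
          rw [Finset.sum_sub_distrib, Finset.sum_add_distrib, Finset.sum_add_distrib,
            ← Finset.mul_sum, ← Finset.mul_sum, ← Finset.mul_sum, ← Finset.mul_sum, h1]
          have h2 := (energy_le (band N κ) g).trans (pow_le_pow_left₀ (norm_nonneg _) hg 2)
          have h3 := (energy_le (band N κ) h).trans (pow_le_pow_left₀ (norm_nonneg _) hh 2)
          rw [mul_pow, norm_trunc_sq] at h2
          rw [mul_pow, norm_sub_trunc_sq] at h3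
          rw [← energy, ← energy, ← energy]
          linarith
  have hsum : ∑ k ∈ freqBall n, cutSign N k * (2 * (conj (coef u k) * d k).re)
        + 2 * (N + 1 / 2 + m.re) * coneForm N n u =
      ∑ k ∈ freqBall n \ band N κ, (cutSign N k * (2 * (conj (coef u k) * d k).re)
      + 2 * (N + 1 / 2 + m.re) * (cutSign N k * ‖coef u k‖ ^ 2)) +
      ∑ k ∈ band N κ, (cutSign N k * (2 * (conj (coef u k) * d k).re)
      + 2 * (N + 1 / 2 + m.re) * (cutSign N k * ‖coef u k‖ ^ 2)) := by
    rw [Finset.sum_sdiff (band_subset hn), Finset.sum_add_distrib, coneForm, Finset.mul_sum]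
  rw [hsum, ← hXY]
  linarith

/-- The resonant quantity solves `G' = -2 (1 + i ω) N G` up to a bounded error. -/
lemma norm_resonance_deriv_add_le (hF : ‖F‖ ≤ K * ‖u‖)
    (hd : ∀ k, d k = -((1 + Complex.I * ω) * freqSq k) * coef u k - coef F k) :
    ‖∑ k ∈ band N κ, cutSign N k * (d k * coef u (-k) + coef u k * d (-k))
        + 2 * (1 + Complex.I * ω) * N * resonance N κ u‖ ≤
      (2 * (1 + |ω|) * κ + 1) * energy (band N κ) u + K ^ 2 * ‖u‖ ^ 2 := by
  have hω : ‖(1 : ℂ) + Complex.I * ω‖ ≤ 1 + |ω| := by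
    refine (norm_add_le _ _).trans ?_
    simp
  have h1 : ∀ k ∈ band N κ, ‖(cutSign N k * (d k * coef u (-k) + coef u k * d (-k))
      + 2 * (1 + Complex.I * ω) * N * (cutSign N k * (coef u k * coef u (-k))) : ℂ)‖ ≤
      ((1 + |ω|) * κ + 1 / 2) * ‖coef u k‖ ^ 2 + ‖coef F k‖ ^ 2 / 2 +
        (((1 + |ω|) * κ + 1 / 2) * ‖coef u (-k)‖ ^ 2 + ‖coef F (-k)‖ ^ 2 / 2) := by
    intro k hk
    have h2 : (cutSign N k * (d k * coef u (-k) + coef u k * d (-k))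
      + 2 * (1 + Complex.I * ω) * N * (cutSign N k * (coef u k * coef u (-k))) : ℂ) =
      cutSign N k * (-(2 * (1 + Complex.I * ω) * ((freqSq k - N : ℤ) : ℂ))
        * (coef u k * coef u (-k)) - coef F k * coef u (-k) - coef u k * coef F (-k)) := by
      rw [hd, hd, freqSq_neg]; push_cast; ring
    rw [h2, norm_mul, Complex.norm_real, Real.norm_eq_abs, abs_cutSign, one_mul]
    refine (norm_sub_le _ _).trans ((add_le_add_left (norm_sub_le _ _) _).trans ?_)
    rw [norm_mul, norm_neg, norm_mul, norm_mul, norm_mul, norm_mul, norm_mul, Complex.norm_intCast,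
      Complex.norm_ofNat]
    have h3 : |((freqSq k - N : ℤ) : ℝ)| ≤ κ := by exact_mod_cast mem_band.1 hk
    have h4 : 2 * ‖(1 : ℂ) + Complex.I * ω‖ * |((freqSq k - N : ℤ) : ℝ)|
        * (‖coef u k‖ * ‖coef u (-k)‖) ≤ 2 * (1 + |ω|) * κ * (‖coef u k‖ * ‖coef u (-k)‖) := by
      gcongr
    have h5 : 0 ≤ (1 + |ω|) * κ := by positivity
    nlinarith [mul_nonneg h5 (sq_nonneg (‖coef u k‖ - ‖coef u (-k)‖)),
      sq_nonneg (‖coef F k‖ - ‖coef u (-k)‖), sq_nonneg (‖coef u k‖ - ‖coef F (-k)‖)]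
  have h6 := norm_sum_le_of_le _ h1
  rw [Finset.sum_add_distrib, ← Finset.mul_sum, ← resonance, Finset.sum_add_distrib (f := fun k =>
    ((1 + |ω|) * κ + 1 / 2) * ‖coef u k‖ ^ 2 + ‖coef F k‖ ^ 2 / 2), sum_band_neg (fun k =>
    ((1 + |ω|) * κ + 1 / 2) * ‖coef u k‖ ^ 2 + ‖coef F k‖ ^ 2 / 2), Finset.sum_add_distrib,
    ← Finset.mul_sum, ← Finset.sum_div, ← energy, ← energy] at h6
  have h7 := (energy_le (band N κ) F).trans (pow_le_pow_left₀ (norm_nonneg _) hF 2)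
  linarith

/-- The corrected functional `coneForm + 2 Re (γ G)`: with `-2 i ω N γ` the conjugate mean of
`b`, the rotation of the resonant quantity `G` cancels its contribution to the evolution of
`coneForm`, so that the functional decays up to the modes beyond the truncation. -/
theorem lyapunov_deriv_le (hn : N + κ ≤ n) (hK : 0 ≤ K) (hm : ‖m‖ ≤ K) (hF : ‖F‖ ≤ K * ‖u‖)
    (hg : ‖g‖ ≤ (1 / 16) * ‖trunc (band N κ) u‖) (hh : ‖h‖ ≤ K * ‖u - trunc (band N κ) u‖)
    (hband : ∀ k ∈ band N κ, coef F k =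
      m * coef u k + m' * conj (coef u (-k)) + coef g k + coef h k)
    (hd : ∀ k, d k = -((1 + Complex.I * ω) * freqSq k) * coef u k - coef F k)
    (hκ : K + 8 * K ^ 2 + 1 ≤ κ) (hδ0 : 0 ≤ δ)
    (hδ : 16 * δ * (3 + 2 * K + 2 * (1 + |ω|) * κ + K ^ 2) ≤ 1)
    (hγ : ‖γ‖ ≤ δ) (hγ' : ‖γ'‖ ≤ δ) (hγm : -2 * Complex.I * ω * N * γ = conj m') :
    ∑ k ∈ freqBall n, cutSign N k * (2 * (conj (coef u k) * d k).re)
        + 2 * (γ' * resonance N κ u + γ *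
          ∑ k ∈ band N κ, cutSign N k * (d k * coef u (-k) + coef u k * d (-k))).re
        + 2 * (N + 1 / 2 + m.re) * (coneForm N n u + 2 * (γ * resonance N κ u).re) ≤
      (8 * K ^ 2 + 1 / 4) * (‖u‖ ^ 2 - energy (freqBall n) u) := by
  have hA := coneForm_deriv_le hn hm hF hg hh hband hd
  have hB := norm_resonance_deriv_add_le (N := N) (κ := κ) hF hd
  have hG := norm_resonance_le N κ u
  have hXY : energy (freqBall n \ band N κ) u + energy (band N κ) u = energy (freqBall n) u :=
    Finset.sum_sdiff (band_subset hn)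
  have hX0 := energy_nonneg (band N κ) u
  have hY0 := energy_nonneg (freqBall n \ band N κ) u
  have hτ0 := energy_le (freqBall n) u
  set G := resonance N κ u
  set D := ∑ k ∈ band N κ, (cutSign N k : ℂ) * (d k * coef u (-k) + coef u k * d (-k))
  set X := energy (band N κ) u
  set Y := energy (freqBall n \ band N κ) u
  set τ := ‖u‖ ^ 2 - energy (freqBall n) u
  set E := D + 2 * (1 + Complex.I * ω) * N * G with hE
  have hu : ‖u‖ ^ 2 = X + Y + τ := by linarith
  -- the rotation produces `conj m' * G`, which compensates `m' * conj G`
  have h1 : (γ' * G + γ * D).re + 2 * (N + 1 / 2 + m.re) * (γ * G).re =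
      (m' * conj G).re + (γ' * G + γ * (E + (1 + 2 * m.re) * G)).re := by
    have h2 : γ * D = conj m' * G + γ * (E + ((1 + 2 * m.re : ℝ) : ℂ) * G)
        - ((2 * (N + 1 / 2 + m.re) : ℝ) : ℂ) * (γ * G) := by
      rw [← hγm, hE]; push_cast; ring
    have h3 : (conj m' * G).re = (m' * conj G).re := by
      rw [← Complex.conj_re, map_mul, Complex.conj_conj]
    rw [h2, Complex.add_re, Complex.sub_re, Complex.re_ofReal_mul, Complex.add_re (conj m' * G), h3,
      Complex.add_re (γ' * G)]
    push_cast
    ring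
  have h4 : (γ' * G + γ * (E + (1 + 2 * m.re) * G)).re ≤
      δ * X + δ * ((2 * (1 + |ω|) * κ + 1) * X + K ^ 2 * ‖u‖ ^ 2 + (1 + 2 * K) * X) := by
    refine (Complex.re_le_norm _).trans ((norm_add_le _ _).trans ?_)
    rw [norm_mul, norm_mul]
    have h5 : ‖(1 + 2 * m.re : ℂ) * G‖ ≤ (1 + 2 * K) * X := by
      rw [norm_mul]
      have : ‖(1 + 2 * m.re : ℂ)‖ ≤ 1 + 2 * K := by
        refine (norm_add_le _ _).trans ?_
        have := (Complex.abs_re_le_norm m).trans hm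
        simp; linarith
      gcongr
    gcongr
    exact (norm_add_le _ _).trans (add_le_add hB h5)
  have h6 : δ * (3 + 2 * K + 2 * (1 + |ω|) * κ + K ^ 2) * X ≤ X / 16 := by
    nlinarith
  have h7 : δ * K ^ 2 ≤ 1 / 16 := by
    have h8 : δ * K ^ 2 ≤ δ * (3 + 2 * K + 2 * (1 + |ω|) * κ + K ^ 2) := by
      gcongr
      have : 0 ≤ 3 + 2 * K + 2 * (1 + |ω|) * κ := by positivity
      linarith
    linarith
  have h9 : δ * K ^ 2 * (Y + τ) ≤ (Y + τ) / 16 := by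
    have : 0 ≤ τ := sub_nonneg.2 hτ0
    nlinarith
  have h10 : 0 ≤ (κ - K - 8 * K ^ 2 - 1) * Y := mul_nonneg (by linarith) hY0
  rw [hu] at h4
  nlinarith

end FixedTime

/-! ### Averaging of the coefficients over a sparse band -/

lemma coef_reaction_const (c c' : ℂ) (u : H) (k : Fin 3 → ℤ) :
    coef (reaction (c • 1) (c' • 1) u) k = c * coef u k + c' * conj (coef u (-k)) := by
  have h := add_reaction (c • 1) (c • 0) (c' • 0) (c' • 1) u
  rw [smul_zero, add_zero, smul_zero, zero_add] at h
  have hsmul : ∀ (z : ℂ) (w : H), coef (z • w) k = z * coef w k := fun z w => by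
    rw [coef_eq_inner, inner_smul_right, coef_eq_inner]
  have h1 := smul_reaction c 1 0 u
  have h2 := smul_reaction c' 0 1 u
  rw [smul_zero] at h1 h2
  rw [h, coef_add, h1, h2, hsmul, hsmul, ← chi_zero, coef_reaction_chi_left,
    coef_reaction_chi_right, sub_zero, zero_sub]

/-- On a sparse band the coefficients act through their means, up to a small error `g` and the
contribution of the modes outside the band. -/
lemma exists_coef_reaction_band {N κ R : ℕ}
    (hB : ∀ k ∈ band N κ, ∀ l ∈ band N κ, k ≠ l → (R : ℤ) < freqSq (k - l)) {p q : C(Torus, ℂ)}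
    (hp : ∃ p' ∈ oscPoly R, ‖fluct p - p'‖ ≤ 1 / 32)
    (hq : ∃ q' ∈ oscPoly R, ‖fluct q - q'‖ ≤ 1 / 32) (u : H) :
    ∃ g : H, ‖g‖ ≤ (1 / 16) * ‖trunc (band N κ) u‖ ∧ ∀ k ∈ band N κ, coef (reaction p q u) k =
      mean p * coef u k + mean q * conj (coef u (-k)) + coef g k
        + coef (reaction p q (u - trunc (band N κ) u)) k := by
  obtain ⟨p', hp', hpp⟩ := hp
  obtain ⟨q', hq', hqq⟩ := hq
  set w := trunc (band N κ) u with hw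
  refine ⟨reaction (fluct p - p') (fluct q - q') w, norm_reaction_le (fun x => ?_) w,
    fun k hk => ?_⟩
  · have h1 := (fluct p - p').norm_coe_le_norm x
    have h2 := (fluct q - q').norm_coe_le_norm x
    linarith
  · have hdec : ∀ r r' : C(Torus, ℂ), r = mean r • 1 + (r' + (fluct r - r')) := fun r r' => by
      rw [fluct_apply]; abel
    have h1 : coef (reaction p q w) k = mean p * coef u k + mean q * conj (coef u (-k))
        + coef (reaction (fluct p - p') (fluct q - q') w) k := by
      conv_lhs => rw [hdec p p', hdec q q']
      rw [add_reaction, add_reaction, coef_add, coef_add, coef_reaction_const,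
        coef_reaction_oscPoly (fun _ => neg_mem_band) hB (fun l hl => ?_) hp' hq' hk, hw,
        coef_trunc, coef_trunc, if_pos hk, if_pos (neg_mem_band hk), zero_add]
      rw [hw, coef_trunc, if_neg hl]
    rw [← h1, ← coef_add, ← reaction_add, add_sub_cancel]

/-! ### The evolution of the Fourier coefficients -/

lemma continuous_coef (k : Fin 3 → ℤ) : Continuous fun u : H => coef u k := by
  simp only [coef_eq_inner]
  fun_prop

lemma continuous_energy (T : Finset (Fin 3 → ℤ)) : Continuous (energy T) :=
  continuous_finsetSum _ fun k _ => (continuous_coef k).norm.pow 2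

lemma monotone_freqBall : Monotone freqBall := fun m n hmn k hk => by
  rw [mem_freqBall] at hk ⊢
  omega

lemma energy_mono {S T : Finset (Fin 3 → ℤ)} (h : S ⊆ T) (u : H) : energy S u ≤ energy T u :=
  Finset.sum_le_sum_of_subset_of_nonneg h fun _ _ _ => by positivity

lemma tendsto_energy_freqBall (u : H) :
    Filter.Tendsto (fun n => energy (freqBall n) u) Filter.atTop (nhds (‖u‖ ^ 2)) :=
  (hasSum_normSq_coef u).comp (Filter.tendsto_atTop_finset_of_monotone monotone_freqBall fun k =>
    ⟨(freqSq k).toNat, mem_freqBall.2 (by have := freqSq_nonneg k; omega)⟩)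

lemma coneForm_eq {N n : ℕ} (h : N ≤ n) (u : H) :
    coneForm N n u = energy (freqBall n) u - 2 * energy (freqBall N) u := by
  have h1 : energy (freqBall N) u =
      ∑ k ∈ freqBall n, if freqSq k ≤ N then ‖coef u k‖ ^ 2 else 0 := by
    rw [← Finset.sum_filter, energy]
    refine Finset.sum_congr ?_ fun _ _ => rfl
    ext k
    rw [Finset.mem_filter, mem_freqBall, mem_freqBall]
    omega
  rw [h1, coneForm, energy, Finset.mul_sum, ← Finset.sum_sub_distrib]
  refine Finset.sum_congr rfl fun k _ => ?_
  rw [cutSign]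
  split_ifs <;> ring

/-- On compact time intervals the modes beyond `n` are uniformly small. -/
lemma eventually_tail_le {v : ℝ → H} {s t ε : ℝ} (hv : ContinuousOn v (Icc s t)) (hε : 0 < ε) :
    ∀ᶠ n in Filter.atTop, ∀ r ∈ Icc s t, ‖v r‖ ^ 2 - energy (freqBall n) (v r) ≤ ε := by
  have h := Monotone.tendstoUniformlyOn_of_forall_tendsto (s := Icc s t)
    (F := fun n r => energy (freqBall n) (v r)) (f := fun r => ‖v r‖ ^ 2) isCompact_Icc
    (fun n => (continuous_energy _).comp_continuousOn hv)
    (fun r _ m n hmn => energy_mono (monotone_freqBall hmn) _) (hv.norm.pow 2)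
    (fun r _ => tendsto_energy_freqBall _)
  filter_upwards [Metric.tendstoUniformlyOn_iff.1 h ε hε] with n hn r hr
  have := hn r hr
  rw [Real.dist_eq] at this
  exact (le_abs_self _).trans this.le

section Solution

variable {ω : ℝ} {K : ℝ≥0} {a b : ℝ → Torus → ℂ} {v : ℝ → H}

/-- The lower order terms of the equation along `v`. -/
def forcing (hab : CoeffBound K a b) (v : ℝ → H) (t : ℝ) : H :=
  reaction (slice hab.contDiff_left t) (slice hab.contDiff_right t) (v t)

/-- The time derivative of the Fourier coefficient of `v` at the frequency `k`. -/
def coefDeriv (ω : ℝ) (hab : CoeffBound K a b) (v : ℝ → H) (t : ℝ) (k : Fin 3 → ℤ) : ℂ :=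
  -((1 + Complex.I * ω) * freqSq k) * coef (v t) k - coef (forcing hab v t) k

lemma norm_forcing_le (hab : CoeffBound K a b) (v : ℝ → H) (t : ℝ) :
    ‖forcing hab v t‖ ≤ K * ‖v t‖ :=
  norm_reaction_le (fun x => hab.norm_add_norm_le t x) _

lemma hasDerivWithinAt_coef (hab : CoeffBound K a b) (hv : IsBoundedBackwardSolution ω a b v)
    {t : ℝ} (ht : t ≤ 0) (k : Fin 3 → ℤ) :
    HasDerivWithinAt (fun s => coef (v s) k) (coefDeriv ω hab v t k) (Iic 0) t := by
  have h := (hv.equation (chi (-k)) (isSmooth_chi _) t ht).const_mul (normConst : ℂ)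
  simp only [← coef_eq_integral] at h
  refine h.congr_deriv ?_
  have h1 : ∫ x, v t x * torusLaplacian (chi (-k)) x =
      -(freqSq k : ℂ) * ∫ x, v t x * chi (-k) x := by
    rw [← integral_const_mul]
    congr 1
    ext x
    rw [torusLaplacian_chi, freqSq_neg]
    ring
  rw [h1, coefDeriv, forcing, coef_reaction, coef_eq_integral]
  simp only [slice_apply]
  ring

lemma hasDerivWithinAt_normSq_coef (hab : CoeffBound K a b)
    (hv : IsBoundedBackwardSolution ω a b v) {t : ℝ} (ht : t ≤ 0) (k : Fin 3 → ℤ) :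
    HasDerivWithinAt (fun s => ‖coef (v s) k‖ ^ 2)
      (2 * (conj (coef (v t) k) * coefDeriv ω hab v t k).re) (Iic 0) t := by
  have h := (hasDerivWithinAt_coef hab hv ht k).norm_sq
  rwa [Complex.inner, mul_comm (coefDeriv ω hab v t k)] at h

lemma hasDerivWithinAt_coneForm (hab : CoeffBound K a b) (hv : IsBoundedBackwardSolution ω a b v)
    (N n : ℕ) {t : ℝ} (ht : t ≤ 0) : HasDerivWithinAt (fun s => coneForm N n (v s))
      (∑ k ∈ freqBall n, cutSign N k * (2 * (conj (coef (v t) k) * coefDeriv ω hab v t k).re))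
      (Iic 0) t :=
  HasDerivWithinAt.fun_sum fun k _ => (hasDerivWithinAt_normSq_coef hab hv ht k).const_mul _

lemma hasDerivWithinAt_resonance (hab : CoeffBound K a b) (hv : IsBoundedBackwardSolution ω a b v)
    (N κ : ℕ) {t : ℝ} (ht : t ≤ 0) : HasDerivWithinAt (fun s => resonance N κ (v s))
      (∑ k ∈ band N κ, cutSign N k * (coefDeriv ω hab v t k * coef (v t) (-k)
        + coef (v t) k * coefDeriv ω hab v t (-k))) (Iic 0) t :=
  HasDerivWithinAt.fun_sum fun k _ => ((hasDerivWithinAt_coef hab hv ht k).mul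
    (hasDerivWithinAt_coef hab hv ht (-k))).const_mul _

/-! ### The invariant cone and backward growth -/

/-- The amplitude `γ` of the corrector, with `-2 i ω N γ` the conjugate mean of `b`. -/
def corrector (ω : ℝ) (hab : CoeffBound K a b) (N : ℕ) (t : ℝ) : ℂ :=
  Complex.I / (2 * ω * N) * conj (mean (slice hab.contDiff_right t))

lemma norm_I_div (ω : ℝ) (N : ℕ) : ‖(Complex.I / (2 * ω * N) : ℂ)‖ = 1 / (2 * |ω| * N) := by
  simp

lemma norm_corrector_le (hab : CoeffBound K a b) (N : ℕ) (t : ℝ) :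
    ‖corrector ω hab N t‖ ≤ K / (2 * |ω| * N) := by
  rw [corrector, norm_mul, norm_I_div, RCLike.norm_conj, div_mul_eq_mul_div, one_mul]
  have := norm_mean_slice_le hab.contDiff_right (le_add_self.trans hab.bound) t
  gcongr

lemma exists_hasDerivAt_corrector (hab : CoeffBound K a b) (N : ℕ) (t : ℝ) :
    ∃ d : ℂ, HasDerivAt (corrector ω hab N) d t ∧ ‖d‖ ≤ K / (2 * |ω| * N) := by
  obtain ⟨d, hd, hdK⟩ :=
    exists_hasDerivAt_mean_slice hab.contDiff_right (le_add_self.trans hab.bound) t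
  refine ⟨Complex.I / (2 * ω * N) * conj d, hd.star.const_mul _, ?_⟩
  rw [norm_mul, norm_I_div, RCLike.norm_conj, div_mul_eq_mul_div, one_mul]
  gcongr

lemma corrector_spec (hω : ω ≠ 0) (hab : CoeffBound K a b) {N : ℕ} (hN : 0 < N) (t : ℝ) :
    -2 * Complex.I * ω * N * corrector ω hab N t =
      conj (mean (slice hab.contDiff_right t)) := by
  have h1 : (ω : ℂ) ≠ 0 := by exact_mod_cast hω
  have h2 : (N : ℂ) ≠ 0 := by exact_mod_cast hN.ne'
  rw [corrector]
  field_simp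
  linear_combination (-conj (mean (slice hab.contDiff_right t))) * Complex.I_sq

/-- An exponent `A` with `A' = 2 (N + 1/2 + Re ⟨a⟩)`, the rate at which the Lyapunov functional
decays. -/
lemma exists_exponent (hab : CoeffBound K a b) {N : ℕ} (hN : (K : ℝ) ≤ N) : ∃ A : ℝ → ℝ,
    (∀ t, HasDerivAt A (2 * (N + 1 / 2 + (mean (slice hab.contDiff_left t)).re)) t) ∧
      ∀ t ≤ 0, A t ≤ t := by
  have ha := le_self_add.trans hab.bound
  set f : ℝ → ℝ := fun t => 2 * (N + 1 / 2 + (mean (slice hab.contDiff_left t)).re) with hf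
  have hm : Continuous fun t => mean (slice hab.contDiff_left t) :=
    continuous_iff_continuousAt.2 fun t => by
      obtain ⟨d, hd, -⟩ := exists_hasDerivAt_mean_slice hab.contDiff_left ha t
      exact hd.continuousAt
  have hc : Continuous f := by
    have := Complex.continuous_re.comp hm
    exact continuous_const.mul (continuous_const.add this)
  have h1 : ∀ t, 1 ≤ f t := fun t => by
    have h2 := (Complex.abs_re_le_norm _).trans (norm_mean_slice_le hab.contDiff_left ha t)
    have h3 := neg_abs_le (mean (slice hab.contDiff_left t)).re
    simp only [hf]
    linarith
  refine ⟨fun t => ∫ r in (0 : ℝ)..t, f r, fun t => hc.integral_hasStrictDerivAt 0 t |>.hasDerivAt,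
    fun t ht => ?_⟩
  have h2 := intervalIntegral.integral_mono_on ht (f := fun _ => (1 : ℝ)) (g := f)
    (μ := volume) intervalIntegrable_const (hc.intervalIntegrable _ _) fun r _ => h1 r
  rw [intervalIntegral.integral_const, smul_eq_mul, intervalIntegral.integral_symm] at h2
  linarith

/-- The relations between the cut `N`, the half-width `κ` of the band and the degree `R` of
approximation under which the cone of `norm_sq_le_four_mul_energy` captures all bounded backward solutions:
the band is wide and sparse, and `N` is large. -/
structure Admissible (ω : ℝ) (K : ℝ≥0) (κ R N : ℕ) : Prop where
  width : (K : ℝ) + 8 * K ^ 2 + 1 ≤ κ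
  approx : ∀ g ∈ lipBall K, ∃ p ∈ oscPoly R, ‖fluct g - p‖ ≤ 1 / 32
  sparse : ∀ k ∈ band N κ, ∀ l ∈ band N κ, k ≠ l → (R : ℤ) < freqSq (k - l)
  le_cut : (K : ℝ) ≤ N
  cut_pos : 0 < N
  small : 16 * (K / (2 * |ω| * N)) * (3 + 2 * K + 2 * (1 + |ω|) * κ + (K : ℝ) ^ 2) ≤ 1

/-- The Lyapunov functional, without truncation. -/
def lyapunov (N κ : ℕ) (γ : ℂ) (u : H) : ℝ :=
  ‖u‖ ^ 2 - 2 * energy (freqBall N) u + 2 * (γ * resonance N κ u).re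

variable {κ R N : ℕ}

lemma truncated_decay (hω : ω ≠ 0) (hab : CoeffBound K a b)
    (hv : IsBoundedBackwardSolution ω a b v) (hN : Admissible ω K κ R N) {A : ℝ → ℝ}
    (hA : ∀ t, HasDerivAt A (2 * (N + 1 / 2 + (mean (slice hab.contDiff_left t)).re)) t)
    (hA0 : ∀ t ≤ 0, A t ≤ t) {n : ℕ} (hn : N + κ ≤ n) {s t ε : ℝ} (hst : s ≤ t) (ht : t ≤ 0)
    (hε : ∀ r ∈ Icc s t, ‖v r‖ ^ 2 - energy (freqBall n) (v r) ≤ ε) :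
    Real.exp (A t) * (coneForm N n (v t) + 2 * (corrector ω hab N t * resonance N κ (v t)).re) -
      Real.exp (A s) * (coneForm N n (v s) + 2 * (corrector ω hab N s * resonance N κ (v s)).re) ≤
      (8 * K ^ 2 + 1 / 4) * ε * (t - s) := by
  have hder : ∀ r ≤ 0, ∃ d : ℝ, HasDerivWithinAt (fun r => Real.exp (A r) *
      (coneForm N n (v r) + 2 * (corrector ω hab N r * resonance N κ (v r)).re)) d (Iic 0) r ∧
      d ≤ (8 * K ^ 2 + 1 / 4) * (‖v r‖ ^ 2 - energy (freqBall n) (v r)) := by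
    intro r hr
    obtain ⟨γ', hγ', hγK⟩ := exists_hasDerivAt_corrector (ω := ω) hab N r
    obtain ⟨g, hg, hband⟩ := exists_coef_reaction_band hN.sparse
      (hN.approx _ (slice_mem_lipBall hab.contDiff_left (le_self_add.trans hab.bound) r))
      (hN.approx _ (slice_mem_lipBall hab.contDiff_right (le_add_self.trans hab.bound) r)) (v r)
    have hle := lyapunov_deriv_le hn K.coe_nonneg
      (norm_mean_slice_le hab.contDiff_left (le_self_add.trans hab.bound) r)
      (norm_forcing_le hab v r) hg (norm_reaction_le (fun x => hab.norm_add_norm_le r x) _)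
      hband (d := coefDeriv ω hab v r) (fun k => rfl) hN.width (by positivity) hN.small
      (norm_corrector_le hab N r) hγK (corrector_spec hω hab hN.cut_pos r)
    have h1 := (hγ'.hasDerivWithinAt (s := Iic 0)).mul (hasDerivWithinAt_resonance hab hv N κ hr)
    have h2 := Complex.reCLM.hasFDerivAt.comp_hasDerivWithinAt r h1
    have h3 := (hA r).exp.hasDerivWithinAt (s := Iic 0) |>.mul
      ((hasDerivWithinAt_coneForm hab hv N n hr).add (h2.const_mul 2))
    refine ⟨_, h3, ?_⟩
    have hE : Real.exp (A r) ≤ 1 := Real.exp_le_one_iff.2 ((hA0 r hr).trans hr)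
    have hE0 := Real.exp_pos (A r)
    have hτ := sub_nonneg.2 (energy_le (freqBall n) (v r))
    have h4 := mul_le_mul_of_nonneg_left hle hE0.le
    have h5 : Real.exp (A r) * ((8 * (K : ℝ) ^ 2 + 1 / 4)
        * (‖v r‖ ^ 2 - energy (freqBall n) (v r))) ≤
        (8 * (K : ℝ) ^ 2 + 1 / 4) * (‖v r‖ ^ 2 - energy (freqBall n) (v r)) :=
      mul_le_of_le_one_left (by positivity) hE
    refine le_trans (le_of_eq ?_) (h4.trans h5)
    simp only [Function.comp_apply, Complex.reCLM_apply, Pi.mul_apply, Pi.add_apply]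
    ring
  have hsub : Icc s t ⊆ Iic 0 := fun r hr => hr.2.trans ht
  have hint : ∀ r ∈ interior (Icc s t), r < 0 := fun r hr => by
    rw [interior_Icc] at hr; exact hr.2.trans_le ht
  refine (convex_Icc s t).image_sub_le_mul_sub_of_deriv_le (f := fun r => Real.exp (A r) *
    (coneForm N n (v r) + 2 * (corrector ω hab N r * resonance N κ (v r)).re))
    (C := (8 * (K : ℝ) ^ 2 + 1 / 4) * ε) (fun r hr => ?_) (fun r hr => ?_)
    (fun r hr => ?_) s (left_mem_Icc.2 hst) t (right_mem_Icc.2 hst) hst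
  · obtain ⟨d, hd, -⟩ := hder r (hsub hr)
    exact hd.continuousWithinAt.mono hsub
  · obtain ⟨d, hd, -⟩ := hder r (hint r hr).le
    exact (hd.hasDerivAt (Iic_mem_nhds (hint r hr))).differentiableAt.differentiableWithinAt
  · obtain ⟨d, hd, hle⟩ := hder r (hint r hr).le
    rw [(hd.hasDerivAt (Iic_mem_nhds (hint r hr))).deriv]
    refine hle.trans ?_
    have := hε r (interior_subset hr)
    gcongr

lemma lyapunov_decay (hω : ω ≠ 0) (hab : CoeffBound K a b)
    (hv : IsBoundedBackwardSolution ω a b v) (hN : Admissible ω K κ R N) {A : ℝ → ℝ}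
    (hA : ∀ t, HasDerivAt A (2 * (N + 1 / 2 + (mean (slice hab.contDiff_left t)).re)) t)
    (hA0 : ∀ t ≤ 0, A t ≤ t) {s t : ℝ} (hst : s ≤ t) (ht : t ≤ 0) :
    Real.exp (A t) * lyapunov N κ (corrector ω hab N t) (v t) ≤
      Real.exp (A s) * lyapunov N κ (corrector ω hab N s) (v s) := by
  have hlim : ∀ r, Filter.Tendsto (fun n => Real.exp (A r) * (coneForm N n (v r)
      + 2 * (corrector ω hab N r * resonance N κ (v r)).re)) Filter.atTop
      (nhds (Real.exp (A r) * lyapunov N κ (corrector ω hab N r) (v r))) := fun r => by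
    refine Filter.Tendsto.const_mul _ (Filter.Tendsto.add_const _ ?_)
    refine ((tendsto_energy_freqBall (v r)).sub_const _).congr' ?_
    filter_upwards [Filter.eventually_ge_atTop N] with n hn
    rw [coneForm_eq hn]
  have hcont : ContinuousOn v (Icc s t) := hv.continuousOn.mono fun r hr => hr.2.trans ht
  have hle : ∀ ε : ℝ, 0 < ε → Real.exp (A t) * lyapunov N κ (corrector ω hab N t) (v t) -
      Real.exp (A s) * lyapunov N κ (corrector ω hab N s) (v s) ≤
      (8 * K ^ 2 + 1 / 4) * (t - s) * ε := fun ε hε => by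
    refine le_of_tendsto ((hlim t).sub (hlim s)) ?_
    filter_upwards [Filter.eventually_ge_atTop (N + κ), eventually_tail_le hcont hε] with n hn hτ
    refine (truncated_decay hω hab hv hN hA hA0 hn hst ht hτ).trans (le_of_eq ?_)
    ring
  refine sub_nonpos.1 (ge_of_tendsto (x := nhdsWithin 0 (Ioi 0)) (f := fun ε : ℝ =>
    (8 * (K : ℝ) ^ 2 + 1 / 4) * (t - s) * ε) ?_ ?_)
  · have : Continuous fun ε : ℝ => (8 * (K : ℝ) ^ 2 + 1 / 4) * (t - s) * ε := by fun_prop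
    simpa using this.tendsto 0 |>.mono_left nhdsWithin_le_nhds
  · filter_upwards [self_mem_nhdsWithin] with ε hε using hle ε hε

lemma Admissible.small_corrector (hN : Admissible ω K κ R N) : K / (2 * |ω| * N) ≤ 1 / 48 := by
  have h0 : 0 ≤ (K : ℝ) / (2 * |ω| * N) := by positivity
  have h1 : 0 ≤ (K : ℝ) / (2 * |ω| * N) * (2 * K + 2 * (1 + |ω|) * κ + (K : ℝ) ^ 2) := by
    positivity
  nlinarith [hN.small]

lemma abs_corrector_resonance_le (hab : CoeffBound K a b) (hN : Admissible ω K κ R N) (t : ℝ)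
    (u : H) : |2 * (corrector ω hab N t * resonance N κ u).re| ≤ ‖u‖ ^ 2 / 24 := by
  have h1 : ‖corrector ω hab N t * resonance N κ u‖ ≤ 1 / 48 * ‖u‖ ^ 2 := by
    rw [norm_mul]
    exact mul_le_mul ((norm_corrector_le hab N t).trans hN.small_corrector)
      ((norm_resonance_le N κ u).trans (energy_le _ _)) (norm_nonneg _) (by norm_num)
  have h2 := (Complex.abs_re_le_norm _).trans h1
  rw [abs_mul, abs_two]
  linarith

/-- Bounded backward solutions stay in the cone, since outside of it the Lyapunov functional would
grow exponentially backward in time. -/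
lemma norm_sq_le_four_mul_energy (hω : ω ≠ 0) (hab : CoeffBound K a b)
    (hv : IsBoundedBackwardSolution ω a b v) (hN : Admissible ω K κ R N) {t : ℝ} (ht : t ≤ 0) :
    ‖v t‖ ^ 2 ≤ 4 * energy (freqBall N) (v t) := by
  obtain ⟨A, hA, hA0⟩ := exists_exponent hab hN.le_cut
  obtain ⟨M, hM⟩ := hv.bounded
  have hle : ∀ s ≤ t, Real.exp (A t) * lyapunov N κ (corrector ω hab N t) (v t) ≤
      2 * M ^ 2 * Real.exp s := fun s hs => by
    refine (lyapunov_decay hω hab hv hN hA hA0 hs ht).trans ?_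
    have h1 := abs_le.1 (abs_corrector_resonance_le hab hN s (v s))
    have h2 := energy_nonneg (freqBall N) (v s)
    have h3 : ‖v s‖ ^ 2 ≤ M ^ 2 := pow_le_pow_left₀ (norm_nonneg _) (hM s (hs.trans ht)) 2
    have h4 : lyapunov N κ (corrector ω hab N s) (v s) ≤ 2 * M ^ 2 := by
      rw [lyapunov]; linarith [h1.2, sq_nonneg M]
    calc _ ≤ Real.exp (A s) * (2 * M ^ 2) := by gcongr
      _ ≤ Real.exp s * (2 * M ^ 2) := by
        gcongr
        exact hA0 s (hs.trans ht)
      _ = _ := mul_comm _ _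
  have h0 : Real.exp (A t) * lyapunov N κ (corrector ω hab N t) (v t) ≤ 0 := by
    refine ge_of_tendsto (x := Filter.atBot) (f := fun s => 2 * M ^ 2 * Real.exp s) ?_ ?_
    · simpa using Real.tendsto_exp_atBot.const_mul (2 * M ^ 2)
    · filter_upwards [Filter.eventually_le_atBot t] with s hs using hle s hs
  have h1 := abs_le.1 (abs_corrector_resonance_le hab hN t (v t))
  have h2 : lyapunov N κ (corrector ω hab N t) (v t) ≤ 0 := by
    by_contra! h
    exact absurd h0 (not_le.2 (mul_pos (Real.exp_pos _) h))
  rw [lyapunov] at h2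
  linarith [h1.1, energy_nonneg (freqBall N) (v t), sq_nonneg ‖v t‖]

/-- In the cone, the low modes grow at most exponentially backward in time. -/
lemma energy_le_exp_mul (hω : ω ≠ 0) (hab : CoeffBound K a b)
    (hv : IsBoundedBackwardSolution ω a b v) (hN : Admissible ω K κ R N) {t : ℝ} (ht : t ≤ 0) :
    energy (freqBall N) (v t) ≤
      Real.exp (-(2 * N + 1 + 4 * K ^ 2) * t) * energy (freqBall N) (v 0) := by
  set L : ℝ := 2 * N + 1 + 4 * K ^ 2 with hL
  have hder : ∀ r ≤ 0, ∃ d : ℝ, HasDerivWithinAt (fun r => Real.exp (L * r) *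
      energy (freqBall N) (v r)) d (Iic 0) r ∧ 0 ≤ d := by
    intro r hr
    have h1 : HasDerivWithinAt (fun r => energy (freqBall N) (v r))
        (∑ k ∈ freqBall N, 2 * (conj (coef (v r) k) * coefDeriv ω hab v r k).re) (Iic 0) r :=
      HasDerivWithinAt.fun_sum fun k _ => hasDerivWithinAt_normSq_coef hab hv hr k
    have h2 := (((hasDerivAt_id r).const_mul L).exp.hasDerivWithinAt (s := Iic 0)).mul h1
    refine ⟨_, h2, ?_⟩
    have h3 : ∑ k ∈ freqBall N, (-(2 * N + 1) * ‖coef (v r) k‖ ^ 2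
        - ‖coef (forcing hab v r) k‖ ^ 2) ≤
        ∑ k ∈ freqBall N, 2 * (conj (coef (v r) k) * coefDeriv ω hab v r k).re := by
      refine Finset.sum_le_sum fun k hk => ?_
      have h4 : (conj (coef (v r) k) * coefDeriv ω hab v r k).re =
          -(freqSq k) * ‖coef (v r) k‖ ^ 2
            - (conj (coef (v r) k) * coef (forcing hab v r) k).re := by
        have h5 : conj (coef (v r) k) * coefDeriv ω hab v r k =
            ((-(freqSq k) * ‖coef (v r) k‖ ^ 2 : ℝ) : ℂ)
            + ((-(ω * freqSq k * ‖coef (v r) k‖ ^ 2) : ℝ) : ℂ) * Complex.I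
            - conj (coef (v r) k) * coef (forcing hab v r) k := by
          rw [coefDeriv]
          push_cast
          rw [← Complex.conj_mul']
          ring
        rw [h5, Complex.sub_re, Complex.add_re, Complex.ofReal_re, Complex.re_ofReal_mul,
          Complex.I_re]
        ring
      have h6 := neg_two_re_le (s := -1) (η := 1) (by simp) one_pos (coef (v r) k)
        (coef (forcing hab v r) k)
      have h7 : (freqSq k : ℝ) ≤ N := by exact_mod_cast mem_freqBall.1 hk
      have h8 := mul_le_mul_of_nonneg_right h7 (sq_nonneg ‖coef (v r) k‖)
      rw [Complex.re_ofReal_mul] at h6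
      rw [h4]
      linarith
    rw [Finset.sum_sub_distrib, ← Finset.mul_sum, ← energy, ← energy] at h3
    have h9 := (energy_le (freqBall N) (forcing hab v r)).trans
      (pow_le_pow_left₀ (norm_nonneg _) (norm_forcing_le hab v r) 2)
    have h10 := mul_le_mul_of_nonneg_left (norm_sq_le_four_mul_energy hω hab hv hN hr)
      (sq_nonneg (K : ℝ))
    have h11 : 0 ≤ L * energy (freqBall N) (v r) +
        ∑ k ∈ freqBall N, 2 * (conj (coef (v r) k) * coefDeriv ω hab v r k).re := by
      rw [hL]; linarith
    have h12 := mul_nonneg (Real.exp_pos (L * r)).le h11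
    refine h12.trans (le_of_eq ?_)
    simp only [id_eq]
    ring
  have hint : ∀ r ∈ interior (Iic (0 : ℝ)), r < 0 := fun r hr => by rwa [interior_Iic] at hr
  have hmono : MonotoneOn (fun r => Real.exp (L * r) * energy (freqBall N) (v r)) (Iic 0) := by
    refine monotoneOn_of_deriv_nonneg (convex_Iic 0) (fun r hr => ?_) (fun r hr => ?_)
      (fun r hr => ?_)
    · obtain ⟨d, hd, -⟩ := hder r hr
      exact hd.continuousWithinAt
    · obtain ⟨d, hd, -⟩ := hder r (hint r hr).le
      exact (hd.hasDerivAt (Iic_mem_nhds (hint r hr))).differentiableAt.differentiableWithinAt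
    · obtain ⟨d, hd, hle⟩ := hder r (hint r hr).le
      rwa [(hd.hasDerivAt (Iic_mem_nhds (hint r hr))).deriv]
  have h := hmono (mem_Iic.2 ht) (mem_Iic.2 le_rfl) ht
  simp only [mul_zero, Real.exp_zero, one_mul] at h
  rw [neg_mul, Real.exp_neg, inv_mul_eq_div, le_div_iff₀ (Real.exp_pos _), mul_comm]
  exact h

theorem Admissible.norm_le (hω : ω ≠ 0) (hN : Admissible ω K κ R N) (hab : CoeffBound K a b)
    (hv : IsBoundedBackwardSolution ω a b v) {t : ℝ} (ht : t ≤ 0) :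
    ‖v t‖ ≤ 2 * Real.exp (-(N + 1 / 2 + 2 * K ^ 2) * t) * ‖P N (v 0)‖ := by
  refine (sq_le_sq₀ (norm_nonneg _) (by positivity)).1 ?_
  have h1 := norm_sq_le_four_mul_energy hω hab hv hN ht
  have h2 := energy_le_exp_mul hω hab hv hN ht
  have h3 := mul_le_mul_of_nonneg_left
    (energy_le_norm_P_sq (N := N) (fun k => mem_freqBall.1) (v 0))
    (Real.exp_pos (-(2 * N + 1 + 4 * (K : ℝ) ^ 2) * t)).le
  have h4 : Real.exp (-(2 * N + 1 + 4 * (K : ℝ) ^ 2) * t) =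
      Real.exp (-(N + 1 / 2 + 2 * (K : ℝ) ^ 2) * t) ^ 2 := by
    rw [← Real.exp_nat_mul]; congr 1; push_cast; ring
  rw [h4] at h2 h3
  calc _ ≤ 4 * (Real.exp (-(N + 1 / 2 + 2 * (K : ℝ) ^ 2) * t) ^ 2 * ‖P N (v 0)‖ ^ 2) := by
        linarith
    _ = _ := by ring

end Solution

/-- There are arbitrarily large admissible cuts. -/
lemma exists_infinite_admissible (ω : ℝ) (hω : ω ≠ 0) (K : ℝ≥0) :
    ∃ κ R : ℕ, {N : ℕ | Admissible ω K κ R N}.Infinite := by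
  obtain ⟨κ, hκ⟩ := exists_nat_ge ((K : ℝ) + 8 * K ^ 2 + 1)
  obtain ⟨R, hR⟩ := exists_uniform_oscPoly (totallyBounded_lipBall K) (ε := 1 / 32) (by norm_num)
  refine ⟨κ, R, Set.infinite_of_forall_exists_gt fun n => ?_⟩
  set c : ℝ := 3 + 2 * K + 2 * (1 + |ω|) * κ + (K : ℝ) ^ 2 with hc
  have hω' : 0 < |ω| := abs_pos.2 hω
  obtain ⟨M, hM⟩ := exists_nat_ge (8 * K * c / |ω| + K)
  have hc0 : 0 ≤ c := by positivity
  have hq : 0 ≤ 8 * K * c / |ω| := by positivity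
  obtain ⟨N, hMN, hN⟩ := exists_sparse_window κ R (M + n + 1)
  have hMN' : (M : ℝ) ≤ N := by exact_mod_cast (by omega : M ≤ N)
  have hN0 : 0 < N := by omega
  have hN0' : (0 : ℝ) < N := by exact_mod_cast hN0
  refine ⟨N, ⟨hκ, hR, fun k hk l hl hkl => hN k l hkl (mem_band.1 hk) (mem_band.1 hl), ?_, hN0,
    ?_⟩, by omega⟩
  · linarith
  · have h1 : 8 * K * c / |ω| ≤ N := by linarith [K.coe_nonneg]
    rw [div_le_iff₀ hω'] at h1
    rw [mul_div_assoc', div_mul_eq_mul_div, div_le_one (by positivity)]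
    linarith

end GinzburgLandau

end

theorem corollary1 (ω : ℝ) (hω : ω ≠ 0) (K : ℝ≥0) :
    ∃ (S : Set ℕ) (C θ : ℕ → ℝ), S.Infinite ∧
      ∀ N ∈ S, ∀ a b : ℝ → GinzburgLandau.Torus → ℂ, GinzburgLandau.CoeffBound K a b →
        ∀ v : ℝ → GinzburgLandau.H, GinzburgLandau.IsBoundedBackwardSolution ω a b v →
          ∀ t : ℝ, t ≤ 0 →
            ‖v t‖ ≤ C N * Real.exp (-(θ N) * t) * ‖GinzburgLandau.P N (v 0)‖ := by
  obtain ⟨κ, R, hS⟩ := GinzburgLandau.exists_infinite_admissible ω hω K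
  exact ⟨_, fun _ => 2, fun N => N + 1 / 2 + 2 * K ^ 2, hS,
    fun N hN a b hab v hv t ht => hN.norm_le hω hab hv ht⟩
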